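/- Let $k$ be a field of characteristic different from $2$ and let $n\ge 0$ be an integer. Let $E(n)$ be the Hopf algebra over $k$ generated by $c,x_1,\dots,x_n$ with relations $c^2=1$, $x_i^2=0$, $cx_i=-x_ic$ and $x_ix_j=-x_jx_i$ for $i<j$, with coproduct $\Delta(c)=c\otimes c$, $\Delta(x_i)=1\otimes x_i+x_i\otimes c$, counit $\varepsilon(c)=1$, $\varepsilon(x_i)=0$, and antipode $S(c)=c$, $S(x_i)=cx_i$. For $P\subseteq\{1,\dots,n\}$ let $x_P$ be the product of the $x_j$, $j\in P$, in increasing order; the elements $x_P$, $cx_P$ form a basis of $E(n)$, and $u^*$ denotes the element dual to a basis element $u$. For $A=(a_{ij})\in M_n(k)$ let $r_A\colon E(n)\otimes E(n)\to k$ be the linear form $$r_A=\sum_{P}(-1)^{\frac{|P|(|P|-1)}2}\sum_{|F|=|P|}\ \sum_{\eta\in S_{|P|}}\operatorname{sign}(\eta)\,a_{p_1f_{\eta(1)}}\cdots a_{p_sf_{\eta(s)}}\Bigl(x_P^*\otimes x_F^*+(cx_P)^*\otimes x_F^*+(-1)^{|P|}x_P^*\otimes(cx_F)^*-(-1)^{|P|}(cx_P)^*\otimes(cx_F)^*\Bigr),$$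 where $P=\{p_1<\dots<p_s\}$ and $F=\{f_1<\dots<f_s\}$ run over the subsets of $\{1,\dots,n\}$; in particular $r_A(x_i\otimes x_j)=a_{ij}$. For a bialgebra $H$, a coquasi-triangular structure on $H$ is a convolution invertible linear map $r\colon H\otimes H\to k$ such that, for all $g,h,l\in H$, $r(hg\otimes l)=\sum r(h\otimes l_{(1)})r(g\otimes l_{(2)})$, $r(h\otimes gl)=\sum r(h_{(1)}\otimes l)r(h_{(2)}\otimes g)$ and $\sum r(h_{(1)}\otimes l_{(1)})h_{(2)}l_{(2)}=\sum l_{(1)}h_{(1)}r(h_{(2)}\otimes l_{(2)})$. Let $Z_L(H)$ be the group, under convolution, of lazy cocycles: the convolution invertible linear maps $\sigma\colon H\otimes H\to k$ with $$\sum\sigma(g_{(1)}\otimes h_{(1)})\sigma(g_{(2)}h_{(2)}\otimes m)=\sum\sigma(h_{(1)}\otimes m_{(1)})\sigma(g\otimes h_{(2)}m_{(2)}),\qquad \sum\sigma(h_{(1)}\otimes l_{(1)})h_{(2)}l_{(2)}=\sum h_{(1)}l_{(1)}\sigma(h_{(2)}\otimes l_{(2)})$$ for all $g,h,l,m\in H$.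 It acts by $\sigma\cdot r=(\sigma\tau)*r*\sigma^{-1}$, where $\tau$ is the flip and $*$ is the convolution product. Then, for every $A\in M_n(k)$, the form $r_A$ is a coquasi-triangular structure on $E(n)$. For all $A,B\in M_n(k)$, the structures $r_A$ and $r_B$ lie in the same $Z_L(E(n))$-orbit, that is, $\sigma\cdot r_A=r_B$ for some $\sigma\in Z_L(E(n))$, if and only if $A-B$ is a symmetric matrix. -/

import Mathlib

open TensorProduct WithConv

noncomputable section

/-- Generators `c`, `x_1, …, x_n` of the algebra `E(n)`. -/
inductive HopfE.Gen (n : ℕ) : Type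
  | c : HopfE.Gen n
  | x : Fin n → HopfE.Gen n

/-- Relations: `c² = 1`, `x_i² = 0`, `c x_i = -x_i c`, and `x_i x_j = -x_j x_i` for `i < j`. -/
inductive HopfE.Rel (k : Type*) [Field k] (n : ℕ) :
    FreeAlgebra k (HopfE.Gen n) → FreeAlgebra k (HopfE.Gen n) → Prop
  | c_sq : HopfE.Rel k n (FreeAlgebra.ι k Gen.c * FreeAlgebra.ι k Gen.c) 1
  | x_sq (i : Fin n) :
      HopfE.Rel k n (FreeAlgebra.ι k (Gen.x i) * FreeAlgebra.ι k (Gen.x i)) 0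
  | c_x (i : Fin n) :
      HopfE.Rel k n (FreeAlgebra.ι k Gen.c * FreeAlgebra.ι k (Gen.x i))
        (-(FreeAlgebra.ι k (Gen.x i) * FreeAlgebra.ι k Gen.c))
  | x_x (i j : Fin n) (h : i < j) :
      HopfE.Rel k n (FreeAlgebra.ι k (Gen.x i) * FreeAlgebra.ι k (Gen.x j))
        (-(FreeAlgebra.ι k (Gen.x j) * FreeAlgebra.ι k (Gen.x i)))

/-- The algebra `E(n)`, by generators and relations. -/
def HopfE (k : Type*) [Field k] (n : ℕ) : Type _ := RingQuot (HopfE.Rel k n)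

namespace HopfE

variable (k : Type*) [Field k] (n : ℕ)

instance instRing : Ring (HopfE k n) := inferInstanceAs (Ring (RingQuot (HopfE.Rel k n)))

instance instAlgebra : Algebra k (HopfE k n) :=
  inferInstanceAs (Algebra k (RingQuot (HopfE.Rel k n)))

def mk : FreeAlgebra k (Gen n) →ₐ[k] HopfE k n := RingQuot.mkAlgHom k (HopfE.Rel k n)

def c : HopfE k n := mk k n (FreeAlgebra.ι k Gen.c)

variable {n} in
def x (i : Fin n) : HopfE k n := mk k n (FreeAlgebra.ι k (Gen.x i))

variable {k n}

theorem c_mul_c : c k n * c k n = 1 := by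
  have := RingQuot.mkAlgHom_rel k (Rel.c_sq (k := k) (n := n))
  rw [map_mul, map_one] at this
  exact this

theorem x_mul_self (i : Fin n) : x k i * x k i = 0 := by
  have := RingQuot.mkAlgHom_rel k (Rel.x_sq (k := k) i)
  rw [map_mul, map_zero] at this
  exact this

theorem c_mul_x (i : Fin n) : c k n * x k i = -(x k i * c k n) := by
  have := RingQuot.mkAlgHom_rel k (Rel.c_x (k := k) i)
  rw [map_mul, map_neg, map_mul] at this
  exact this

theorem x_mul_x (i j : Fin n) : x k i * x k j = -(x k j * x k i) := by
  have key : ∀ i j : Fin n, i < j → x k i * x k j = -(x k j * x k i) := by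
    intro i j h
    have := RingQuot.mkAlgHom_rel k (Rel.x_x (k := k) i j h)
    rw [map_mul, map_neg, map_mul] at this
    exact this
  rcases lt_trichotomy i j with h | h | h
  · exact key i j h
  · subst h; simp [x_mul_self]
  · rw [key j i h, neg_neg]

theorem cx_mul_cx (i j : Fin n) : c k n * x k i * (c k n * x k j) = -(x k i * x k j) := by
  rw [c_mul_x i, neg_mul, mul_assoc, ← mul_assoc (c k n), c_mul_c, one_mul]

theorem induction {P : HopfE k n → Prop} (hs : ∀ s : k, P (algebraMap k _ s)) (hc : P (c k n))
    (hx : ∀ i, P (x k i)) (hm : ∀ a b, P a → P b → P (a * b))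
    (ha : ∀ a b, P a → P b → P (a + b)) (a : HopfE k n) : P a := by
  obtain ⟨b, rfl⟩ := RingQuot.mkAlgHom_surjective k (HopfE.Rel k n) a
  change P (mk k n b)
  induction b using FreeAlgebra.induction with
  | grade0 r => rw [AlgHom.commutes]; exact hs r
  | grade1 g => cases g with
    | c => exact hc
    | x i => exact hx i
  | mul a b h1 h2 => rw [map_mul]; exact hm _ _ h1 h2
  | add a b h1 h2 => rw [map_add]; exact ha _ _ h1 h2

section lift
variable {B : Type*} [Ring B] [Algebra k B] (C : B) (X : Fin n → B) (hC : C * C = 1)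
    (hX : ∀ i, X i * X i = 0) (hCX : ∀ i, C * X i = -(X i * C))
    (hXX : ∀ i j, i < j → X i * X j = -(X j * X i))

/-- The universal property of `E(n)`. -/
def lift : HopfE k n →ₐ[k] B :=
  RingQuot.liftAlgHom k ⟨FreeAlgebra.lift k (fun g : Gen n => Gen.casesOn g C X), by
    rintro _ _ (_ | i | i | ⟨i, j, h⟩) <;> simp_all⟩

theorem lift_c : lift C X hC hX hCX hXX (c k n) = C := by
  unfold lift c mk
  erw [RingQuot.liftAlgHom_mkAlgHom_apply]
  simp

theorem lift_x (i : Fin n) : lift C X hC hX hCX hXX (x k i) = X i := by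
  unfold lift x mk
  erw [RingQuot.liftAlgHom_mkAlgHom_apply]
  simp

end lift

@[ext]
theorem algHom_ext {B : Type*} [Semiring B] [Algebra k B] {f g : HopfE k n →ₐ[k] B}
    (hc : f (c k n) = g (c k n)) (hx : ∀ i, f (x k i) = g (x k i)) : f = g := by
  refine AlgHom.ext fun a => ?_
  induction a using HopfE.induction with
  | hs s => rw [AlgHom.commutes, AlgHom.commutes]
  | hc => exact hc
  | hx i => exact hx i
  | hm a b h1 h2 => rw [map_mul, map_mul, h1, h2]
  | ha a b h1 h2 => rw [map_add, map_add, h1, h2]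

/-! ### Hopf algebra structure -/

variable (k n)

/-- The coproduct: `Δ(c) = c ⊗ c`, `Δ(x_i) = 1 ⊗ x_i + x_i ⊗ c`. -/
def comulHom : HopfE k n →ₐ[k] HopfE k n ⊗[k] HopfE k n :=
  lift (c k n ⊗ₜ c k n) (fun i => 1 ⊗ₜ x k i + x k i ⊗ₜ c k n)
    (by simp [c_mul_c, Algebra.TensorProduct.one_def])
    (fun i => by simp [mul_add, add_mul, x_mul_self, c_mul_x, tmul_neg])
    (fun i => by
      simp only [mul_add, add_mul, Algebra.TensorProduct.tmul_mul_tmul, one_mul, mul_one, c_mul_c,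
        c_mul_x, tmul_neg, neg_tmul]
      abel)
    (fun i j _ => by
      simp only [mul_add, add_mul, Algebra.TensorProduct.tmul_mul_tmul, one_mul, mul_one, c_mul_c,
        x_mul_x i j, c_mul_x, tmul_neg, neg_tmul]
      abel)

/-- The counit: `ε(c) = 1`, `ε(x_i) = 0`. -/
def counitHom : HopfE k n →ₐ[k] k :=
  lift 1 (fun _ => 0) (by simp) (by simp) (by simp) (by simp)

/-- The antipode as an algebra map to the opposite algebra. -/
def antipodeHom : HopfE k n →ₐ[k] (HopfE k n)ᵐᵒᵖ :=
  lift (MulOpposite.op (c k n)) (fun i => MulOpposite.op (c k n * x k i))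
    (by rw [← MulOpposite.op_mul, c_mul_c, MulOpposite.op_one])
    (fun i => by
      rw [← MulOpposite.op_mul, cx_mul_cx, x_mul_self, neg_zero, MulOpposite.op_zero])
    (fun i => by
      rw [← MulOpposite.op_mul, ← MulOpposite.op_mul, ← MulOpposite.op_neg]
      congr 1
      rw [mul_assoc, ← neg_eq_iff_eq_neg, ← mul_neg, ← c_mul_x])
    (fun i j _ => by
      rw [← MulOpposite.op_mul, ← MulOpposite.op_mul, ← MulOpposite.op_neg, cx_mul_cx, cx_mul_cx,
        x_mul_x j i])

@[simp] theorem comulHom_c : comulHom k n (c k n) = c k n ⊗ₜ c k n := lift_c ..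
@[simp] theorem comulHom_x (i : Fin n) :
    comulHom k n (x k i) = 1 ⊗ₜ x k i + x k i ⊗ₜ c k n := lift_x ..
@[simp] theorem counitHom_c : counitHom k n (c k n) = 1 := lift_c ..
@[simp] theorem counitHom_x (i : Fin n) : counitHom k n (x k i) = 0 := lift_x ..
@[simp] theorem antipodeHom_c : antipodeHom k n (c k n) = MulOpposite.op (c k n) := lift_c ..
@[simp] theorem antipodeHom_x (i : Fin n) :
    antipodeHom k n (x k i) = MulOpposite.op (c k n * x k i) := lift_x ..

instance instBialgebra : Bialgebra k (HopfE k n) :=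
  Bialgebra.ofAlgHom (comulHom k n) (counitHom k n)
    (by ext <;> simp [Algebra.TensorProduct.one_def, add_tmul, tmul_add, add_assoc])
    (by ext <;> simp)
    (by ext <;> simp)

theorem comul_eq (a : HopfE k n) : Coalgebra.comul (R := k) a = comulHom k n a := rfl
theorem counit_eq (a : HopfE k n) : Coalgebra.counit (R := k) a = counitHom k n a := rfl

/-- The antipode: the anti-homomorphism with `S c = c`, `S (x i) = c * x i`. -/
def antipodeMap : HopfE k n →ₗ[k] HopfE k n :=
  (MulOpposite.opLinearEquiv k).symm.toLinearMap ∘ₗ (antipodeHom k n).toLinearMap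

theorem antipodeMap_mul (a b : HopfE k n) :
    antipodeMap k n (a * b) = antipodeMap k n b * antipodeMap k n a := by
  simp [antipodeMap]

instance instHopfAlgebra : HopfAlgebra k (HopfE k n) where
  antipode := antipodeMap k n
  mul_antipode_rTensor_comul := by
    refine LinearMap.ext fun a => ?_
    induction a using HopfE.induction with
    | hs s => simp [Algebra.algebraMap_eq_smul_one, Algebra.TensorProduct.one_def, antipodeMap]
    | hc => simp [comul_eq, counit_eq, c_mul_c, antipodeMap]
    | hx i => simp [comul_eq, counit_eq, mul_assoc, c_mul_x, c_mul_c, antipodeMap]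
    | ha a b h1 h2 => rw [map_add, h1, h2, map_add]
    | hm a b h1 h2 =>
      have e1 := (Coalgebra.Repr.arbitrary k a).eq
      have e2 := (Coalgebra.Repr.arbitrary k b).eq
      generalize Coalgebra.Repr.arbitrary k a = ra at e1
      generalize Coalgebra.Repr.arbitrary k b = rb at e2
      simp only [LinearMap.comp_apply, Bialgebra.comul_mul, Bialgebra.counit_mul] at h1 h2 ⊢
      rw [← e1] at h1
      rw [← e2] at h2
      rw [← e1, ← e2]
      simp only [map_sum, LinearMap.rTensor_tmul, LinearMap.mul'_apply, Finset.sum_mul_sum,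
        Algebra.TensorProduct.tmul_mul_tmul, antipodeMap_mul, Algebra.linearMap_apply] at h1 h2 ⊢
      rw [Finset.sum_comm, map_mul, Algebra.commutes, ← h2, Finset.sum_mul]
      refine Finset.sum_congr rfl fun j _ => ?_
      rw [mul_assoc, ← Algebra.commutes, ← h1, Finset.sum_mul, Finset.mul_sum]
      simp only [mul_assoc]
  mul_antipode_lTensor_comul := by
    refine LinearMap.ext fun a => ?_
    induction a using HopfE.induction with
    | hs s => simp [Algebra.algebraMap_eq_smul_one, Algebra.TensorProduct.one_def, antipodeMap]
    | hc => simp [comul_eq, counit_eq, c_mul_c, antipodeMap]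
    | hx i => simp [comul_eq, counit_eq, ← mul_assoc, c_mul_x, antipodeMap]
    | ha a b h1 h2 => rw [map_add, h1, h2, map_add]
    | hm a b h1 h2 =>
      have e1 := (Coalgebra.Repr.arbitrary k a).eq
      have e2 := (Coalgebra.Repr.arbitrary k b).eq
      generalize Coalgebra.Repr.arbitrary k a = ra at e1
      generalize Coalgebra.Repr.arbitrary k b = rb at e2
      simp only [LinearMap.comp_apply, Bialgebra.comul_mul, Bialgebra.counit_mul] at h1 h2 ⊢
      rw [← e1] at h1
      rw [← e2] at h2
      rw [← e1, ← e2]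
      simp only [map_sum, LinearMap.lTensor_tmul, LinearMap.mul'_apply, Finset.sum_mul_sum,
        Algebra.TensorProduct.tmul_mul_tmul, antipodeMap_mul, Algebra.linearMap_apply] at h1 h2 ⊢
      rw [map_mul, ← h1, Finset.sum_mul]
      refine Finset.sum_congr rfl fun j _ => ?_
      rw [mul_assoc, ← Algebra.commutes, ← h2, Finset.sum_mul, Finset.mul_sum]
      simp only [mul_assoc]

/-! ### The basis `c ^ a * x_P` -/

section basis
variable {n}

/-- `x_P`: the product of the `x j`, `j ∈ P`, in increasing order. -/
def xP (P : Finset (Fin n)) : HopfE k n := (P.sort.map (x k)).prod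

variable {k}

theorem xP_empty : xP k (∅ : Finset (Fin n)) = 1 := by simp [xP]

theorem xP_insert {i : Fin n} {P : Finset (Fin n)} (h : ∀ j ∈ P, i < j) :
    xP k (insert i P) = x k i * xP k P := by
  have hi : i ∉ P := fun hi => lt_irrefl _ (h i hi)
  rw [xP, Finset.sort_insert _ (fun j hj => (h j hj).le) hi]
  simp [xP]

theorem x_mul_xP (i : Fin n) (P : Finset (Fin n)) :
    ∃ s : k, x k i * xP k P = s • xP k (insert i P) := by
  induction P using Finset.induction_on_min with
  | empty => exact ⟨1, by rw [xP_insert (by simp), one_smul]⟩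
  | insert p P hp ih =>
    rcases lt_trichotomy i p with h | h | h
    · refine ⟨1, ?_⟩
      rw [one_smul, xP_insert (P := insert p P)]
      intro j hj
      rcases Finset.mem_insert.1 hj with rfl | hj
      · exact h
      · exact h.trans (hp j hj)
    · subst h
      exact ⟨0, by rw [xP_insert hp, ← mul_assoc, x_mul_self, zero_mul, zero_smul]⟩
    · obtain ⟨s, hs⟩ := ih
      refine ⟨-s, ?_⟩
      rw [xP_insert hp, ← mul_assoc, x_mul_x, neg_mul, mul_assoc, hs, Finset.insert_comm,
        xP_insert (P := insert i P), mul_smul_comm, neg_smul]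
      intro j hj
      rcases Finset.mem_insert.1 hj with rfl | hj
      · exact h
      · exact hp j hj

variable (k) in
/-- `(false, P) ↦ x_P`, `(true, P) ↦ c x_P`. -/
def basisVec (p : Bool × Finset (Fin n)) : HopfE k n :=
  if p.1 then c k n * xP k p.2 else xP k p.2

theorem c_mul_basisVec (a : Bool) (P : Finset (Fin n)) :
    c k n * basisVec k (a, P) = basisVec k (!a, P) := by
  cases a <;> simp [basisVec, ← mul_assoc, c_mul_c]

theorem x_mul_basisVec (i : Fin n) (a : Bool) (P : Finset (Fin n)) :
    ∃ s : k, x k i * basisVec k (a, P) = s • basisVec k (a, insert i P) := by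
  obtain ⟨s, hs⟩ := x_mul_xP (k := k) i P
  cases a
  · exact ⟨s, by simpa [basisVec] using hs⟩
  · refine ⟨-s, ?_⟩
    have : x k i * c k n = -(c k n * x k i) := by rw [c_mul_x, neg_neg]
    simp only [basisVec, if_true]
    rw [← mul_assoc, this, neg_mul, mul_assoc, hs, mul_smul_comm, neg_smul]

theorem span_basisVec : ⊤ ≤ Submodule.span k (Set.range (basisVec k (n := n))) := by
  intro a _
  suffices H : ∀ a : HopfE k n, ∀ v ∈ Submodule.span k (Set.range (basisVec k (n := n))),
      a * v ∈ Submodule.span k (Set.range (basisVec k (n := n))) by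
    have h1 : basisVec k (false, (∅ : Finset (Fin n))) = 1 := by simp [basisVec, xP_empty]
    have := H a 1 (Submodule.subset_span ⟨_, h1⟩)
    rwa [mul_one] at this
  intro a
  have gen : ∀ g : HopfE k n, (∀ p, g * basisVec k p ∈
      Submodule.span k (Set.range (basisVec k (n := n)))) →
      ∀ v ∈ Submodule.span k (Set.range (basisVec k (n := n))),
      g * v ∈ Submodule.span k (Set.range (basisVec k (n := n))) := by
    intro g hg v hv
    induction hv using Submodule.span_induction with
    | mem v hv => obtain ⟨p, rfl⟩ := hv; exact hg p
    | zero => rw [mul_zero]; exact zero_mem _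
    | add v w _ _ h1 h2 => rw [mul_add]; exact add_mem h1 h2
    | smul s v _ h => rw [mul_smul_comm]; exact Submodule.smul_mem _ _ h
  induction a using HopfE.induction with
  | hs s =>
    intro v hv
    rw [← Algebra.smul_def]
    exact Submodule.smul_mem _ _ hv
  | hc =>
    refine gen _ fun p => ?_
    rw [c_mul_basisVec]
    exact Submodule.subset_span ⟨_, rfl⟩
  | hx i =>
    refine gen _ fun p => ?_
    obtain ⟨s, hs⟩ := x_mul_basisVec (k := k) i p.1 p.2
    rw [hs]
    exact Submodule.smul_mem _ _ (Submodule.subset_span ⟨_, rfl⟩)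
  | ha a b h1 h2 =>
    intro v hv
    rw [add_mul]
    exact add_mem (h1 v hv) (h2 v hv)
  | hm a b h1 h2 =>
    intro v hv
    rw [mul_assoc]
    exact h1 _ (h2 v hv)

/-- The number of elements of `P` below `i`. -/
def below (i : Fin n) (P : Finset (Fin n)) : ℕ := (P.filter (· < i)).card

theorem below_insert {i j : Fin n} {P : Finset (Fin n)} (hj : j ∉ P) :
    below i (insert j P) = below i P + if j < i then 1 else 0 := by
  unfold below
  rw [Finset.filter_insert]
  split_ifs with h
  · rw [Finset.card_insert_of_notMem (by simp [hj])]
  · rfl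

variable (k) in
/-- Left multiplication by `c` in coordinates. -/
def opC : Module.End k (Bool × Finset (Fin n) →₀ k) :=
  Finsupp.lift _ k _ fun p => Finsupp.single (!p.1, p.2) 1

variable (k) in
/-- Left multiplication by `x i` in coordinates. -/
def opX (i : Fin n) : Module.End k (Bool × Finset (Fin n) →₀ k) :=
  Finsupp.lift _ k _ fun p => if i ∈ p.2 then 0 else
    Finsupp.single (p.1, insert i p.2) ((if p.1 then -1 else 1) * (-1) ^ below i p.2)

theorem opC_single (a : Bool) (P : Finset (Fin n)) (s : k) :
    opC k (Finsupp.single (a, P) s) = Finsupp.single (!a, P) s := by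
  simp [opC]

theorem opX_single (i : Fin n) (a : Bool) (P : Finset (Fin n)) (s : k) :
    opX k i (Finsupp.single (a, P) s) = if i ∈ P then 0 else
      Finsupp.single (a, insert i P) (s * ((if a then -1 else 1) * (-1) ^ below i P)) := by
  by_cases h : i ∈ P <;> cases a <;> simp [opX, h]

variable (k n) in
/-- The left regular representation in coordinates. -/
def regRep : HopfE k n →ₐ[k] Module.End k (Bool × Finset (Fin n) →₀ k) :=
  lift (opC k) (opX k)
    (by
      refine Finsupp.lhom_ext fun ⟨a, P⟩ s => ?_
      simp [opC_single])
    (fun i => by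
      refine Finsupp.lhom_ext fun ⟨a, P⟩ s => ?_
      by_cases h : i ∈ P <;> simp [opX_single, h])
    (fun i => by
      refine Finsupp.lhom_ext fun ⟨a, P⟩ s => ?_
      by_cases h : i ∈ P <;> cases a <;>
        simp [opX_single, opC_single, h, -Finsupp.single_mul])
    (fun i j hij => by
      refine Finsupp.lhom_ext fun ⟨a, P⟩ s => ?_
      by_cases hi : i ∈ P <;> by_cases hj : j ∈ P
      · simp [opX_single, hi, hj]
      · simp [opX_single, hi, hj]
      · simp [opX_single, hi, hj]
      · have h1 : i ∉ insert j P := by simp [hi, hij.ne]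
        have h2 : j ∉ insert i P := by simp [hj, hij.ne']
        simp only [Module.End.mul_apply, LinearMap.neg_apply, opX_single, if_neg hi, if_neg hj,
          if_neg h1, if_neg h2, below_insert hi, below_insert hj, if_pos hij, if_neg hij.not_gt,
          Finset.insert_comm i j, ← Finsupp.single_neg]
        congr 1
        ring)

theorem regRep_c : regRep k n (c k n) = opC k := lift_c ..

theorem regRep_x (i : Fin n) : regRep k n (x k i) = opX k i := lift_x ..

theorem regRep_xP (P : Finset (Fin n)) :
    regRep k n (xP k P) (Finsupp.single (false, ∅) 1) = Finsupp.single (false, P) 1 := by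
  induction P using Finset.induction_on_min with
  | empty => simp [xP_empty]
  | insert p P hp ih =>
    have h1 : p ∉ P := fun hi => lt_irrefl _ (hp p hi)
    have h2 : below p P = 0 := by
      rw [below, Finset.card_eq_zero, Finset.filter_eq_empty_iff]
      exact fun j hj => (hp j hj).not_gt
    rw [xP_insert hp, map_mul, Module.End.mul_apply, ih]
    simp [regRep_x, opX_single, h1, h2]

theorem regRep_basisVec (p : Bool × Finset (Fin n)) :
    regRep k n (basisVec k p) (Finsupp.single (false, ∅) 1) = Finsupp.single p 1 := by
  rcases p with ⟨a, P⟩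
  cases a
  · simp [basisVec, regRep_xP]
  · simp [basisVec, regRep_xP, opC_single, regRep_c]

theorem linearIndependent_basisVec : LinearIndependent k (basisVec k (n := n)) := by
  let f : HopfE k n →ₗ[k] (Bool × Finset (Fin n) →₀ k) :=
    (LinearMap.applyₗ (Finsupp.single (false, ∅) 1)) ∘ₗ (regRep k n).toLinearMap
  refine LinearIndependent.of_comp f ?_
  have : f ∘ basisVec k = fun p => Finsupp.single p (1 : k) := funext regRep_basisVec
  rw [this]
  exact Finsupp.linearIndependent_single_one k _

variable (k n) in
/-- The basis of `E(n)` given by the elements `x_P` and `c x_P`. -/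
def basis : Module.Basis (Bool × Finset (Fin n)) k (HopfE k n) :=
  Module.Basis.mk linearIndependent_basisVec span_basisVec

end basis

end HopfE

set_option linter.unusedSimpArgs false

/-! ## Lazy cocycles and coquasi-triangular structures on a bialgebra -/

section Forms

variable (k : Type*) [Field k] (H : Type*) [Ring H] [Bialgebra k H]

/-- The convolution algebra `(H ⊗ H)^*`, whose elements are the linear maps `H ⊗ H → k`. -/
abbrev Form : Type _ := WithConv (H ⊗[k] H →ₗ[k] k)

variable {k H}

/-- A linear map `σ : H ⊗ H → k` regarded as a linear map `H ⊗ H → H`, `h ⊗ l ↦ σ(h ⊗ l) 1`. -/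
def Form.toH (σ : Form k H) : WithConv (H ⊗[k] H →ₗ[k] H) :=
  toConv (Algebra.linearMap k H ∘ₗ σ.ofConv)

/-- The flipped form `σ ∘ τ`, `h ⊗ l ↦ σ(l ⊗ h)`. -/
def Form.flip (σ : Form k H) : Form k H :=
  toConv (σ.ofConv ∘ₗ (TensorProduct.comm k H H).toLinearMap)

variable (k H) in
/-- The multiplication `h ⊗ l ↦ h l`, as an element of the convolution algebra. -/
def mulConv : WithConv (H ⊗[k] H →ₗ[k] H) := toConv (LinearMap.mul' k H)

variable (k H) in
/-- The opposite multiplication `h ⊗ l ↦ l h`, as an element of the convolution algebra. -/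
def mulOpConv : WithConv (H ⊗[k] H →ₗ[k] H) :=
  toConv (LinearMap.mul' k H ∘ₗ (TensorProduct.comm k H H).toLinearMap)

/-- The identity `∑ σ(g₁ ⊗ h₁) σ(g₂ h₂ ⊗ m) = ∑ σ(h₁ ⊗ m₁) σ(g ⊗ h₂ m₂)` for all `g, h, m`.
Here `(σ.toH * mulConv k H) (g ⊗ h) = ∑ σ(g₁ ⊗ h₁) g₂ h₂`. -/
def Form.IsLeftCocycle (σ : Form k H) : Prop :=
  ∀ g h m : H, σ ((σ.toH * mulConv k H) (g ⊗ₜ h) ⊗ₜ m) = σ (g ⊗ₜ (σ.toH * mulConv k H) (h ⊗ₜ m))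

/-- The identity `∑ σ(h₁ ⊗ l₁) h₂ l₂ = ∑ h₁ l₁ σ(h₂ ⊗ l₂)` for all `h, l`. -/
def Form.IsLazy (σ : Form k H) : Prop :=
  σ.toH * mulConv k H = mulConv k H * σ.toH

/-- Coquasi-triangular structures: convolution invertible `r : H ⊗ H → k` such that, for all
`g, h, l`,
`r(h g ⊗ l) = ∑ r(h ⊗ l₁) r(g ⊗ l₂)`, `r(h ⊗ g l) = ∑ r(h₁ ⊗ l) r(h₂ ⊗ g)` and
`∑ r(h₁ ⊗ l₁) h₂ l₂ = ∑ l₁ h₁ r(h₂ ⊗ l₂)`. -/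
structure Form.IsCoquasitriangular (r : Form k H) : Prop where
  isUnit : IsUnit r
  mul_left (h g l : H) : r ((h * g) ⊗ₜ l) =
    (toConv (r.ofConv ∘ₗ TensorProduct.mk k H H h) *
      toConv (r.ofConv ∘ₗ TensorProduct.mk k H H g) : WithConv (H →ₗ[k] k)) l
  mul_right (h g l : H) : r (h ⊗ₜ (g * l)) =
    (toConv (r.ofConv ∘ₗ (TensorProduct.mk k H H).flip l) *
      toConv (r.ofConv ∘ₗ (TensorProduct.mk k H H).flip g) : WithConv (H →ₗ[k] k)) h
  comm : r.toH * mulConv k H = mulOpConv k H * r.toH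

/-! ### The group of lazy cocycles -/

/-- Pull-back along a coalgebra map, as a homomorphism of convolution algebras. -/
def convPull {C D A : Type*} [AddCommGroup C] [Module k C] [Coalgebra k C] [AddCommGroup D]
    [Module k D] [Coalgebra k D] [Ring A] [Algebra k A] (φ : C →ₗc[k] D) :
    WithConv (D →ₗ[k] A) →* WithConv (C →ₗ[k] A) where
  toFun f := toConv (f.ofConv ∘ₗ φ.toLinearMap)
  map_one' := by ext a; simp
  map_mul' f g := by rw [LinearMap.convMul_comp_coalgHom_distrib, toConv_ofConv]

variable (k H) in
/-- `Form.toH` as a homomorphism of convolution algebras. -/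
def toHHom : Form k H →* WithConv (H ⊗[k] H →ₗ[k] H) where
  toFun := Form.toH
  map_one' := by ext a; simp [Form.toH]
  map_mul' f g := by
    have := LinearMap.algHom_comp_convMul_distrib (Algebra.ofId k H) f g
    exact congrArg toConv this

variable (k H) in
/-- `(g ⊗ h) ⊗ m ↦ ε(m) g ⊗ h`. -/
def proj12 : (H ⊗[k] H) ⊗[k] H →ₗc[k] H ⊗[k] H :=
  (Coalgebra.TensorProduct.rid k k (H ⊗[k] H)).toCoalgHom.comp
    (Coalgebra.TensorProduct.map (CoalgHom.id k (H ⊗[k] H)) (Coalgebra.counitCoalgHom k H))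

variable (k H) in
/-- `(g ⊗ h) ⊗ m ↦ ε(g) h ⊗ m`. -/
def proj23 : (H ⊗[k] H) ⊗[k] H →ₗc[k] H ⊗[k] H :=
  Coalgebra.TensorProduct.map ((Coalgebra.TensorProduct.lid k H).toCoalgHom.comp
    (Coalgebra.TensorProduct.map (Coalgebra.counitCoalgHom k H) (CoalgHom.id k H)))
    (CoalgHom.id k H)

variable (k H) in
/-- `(g ⊗ h) ⊗ m ↦ g h ⊗ m`. -/
def mul12 : (H ⊗[k] H) ⊗[k] H →ₗc[k] H ⊗[k] H :=
  Coalgebra.TensorProduct.map (Bialgebra.mulCoalgHom k H) (CoalgHom.id k H)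

variable (k H) in
/-- `(g ⊗ h) ⊗ m ↦ g ⊗ h m`. -/
def mul23 : (H ⊗[k] H) ⊗[k] H →ₗc[k] H ⊗[k] H :=
  (Coalgebra.TensorProduct.map (CoalgHom.id k H) (Bialgebra.mulCoalgHom k H)).comp
    (Coalgebra.TensorProduct.assoc k k H H H).toCoalgHom

theorem proj12_tmul (g h m : H) :
    proj12 k H ((g ⊗ₜ h) ⊗ₜ m) = Coalgebra.counit (R := k) m • (g ⊗ₜ h) := rfl

theorem proj23_tmul (g h m : H) :
    proj23 k H ((g ⊗ₜ h) ⊗ₜ m) = (Coalgebra.counit (R := k) g • h) ⊗ₜ m := rfl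

theorem mul12_tmul (g h m : H) : mul12 k H ((g ⊗ₜ h) ⊗ₜ m) = (g * h) ⊗ₜ m := rfl

theorem mul23_tmul (g h m : H) : mul23 k H ((g ⊗ₜ h) ⊗ₜ m) = g ⊗ₜ (h * m) := rfl

theorem convPull_apply {C D A : Type*} [AddCommGroup C] [Module k C] [Coalgebra k C]
    [AddCommGroup D] [Module k D] [Coalgebra k D] [Ring A] [Algebra k A] (φ : C →ₗc[k] D)
    (f : WithConv (D →ₗ[k] A)) (a : C) : convPull φ f a = f (φ a) := rfl

theorem toH_apply (σ : Form k H) (a : H ⊗[k] H) : σ.toH a = algebraMap k H (σ a) := rfl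

theorem mulConv_tmul (g h : H) : mulConv k H (g ⊗ₜ h) = g * h := rfl

/-- Evaluation of a convolution product in Sweedler form on a pure tensor of length three. -/
theorem conv_apply3 {A : Type*} [Ring A] [Algebra k A]
    (f f' : WithConv ((H ⊗[k] H) ⊗[k] H →ₗ[k] A)) {g h m : H} {ι : Type*}
    (rg : Coalgebra.Repr k g ι) (rh : Coalgebra.Repr k h ι) (rm : Coalgebra.Repr k m ι) :
    (f * f') ((g ⊗ₜ h) ⊗ₜ m) = ∑ i ∈ rg.index, ∑ j ∈ rh.index, ∑ l ∈ rm.index,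
      f ((rg.left i ⊗ₜ rh.left j) ⊗ₜ rm.left l) * f' ((rg.right i ⊗ₜ rh.right j) ⊗ₜ rm.right l) := by
  rw [((rg.tmul rh).tmul rm).convMul_apply]
  simp [Coalgebra.Repr.tmul, Finset.sum_product]

theorem conv_apply2 {A : Type*} [Ring A] [Algebra k A]
    (f f' : WithConv (H ⊗[k] H →ₗ[k] A)) {g h : H} {ι : Type*}
    (rg : Coalgebra.Repr k g ι) (rh : Coalgebra.Repr k h ι) :
    (f * f') (g ⊗ₜ h) = ∑ i ∈ rg.index, ∑ j ∈ rh.index,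
      f (rg.left i ⊗ₜ rh.left j) * f' (rg.right i ⊗ₜ rh.right j) := by
  rw [(rg.tmul rh).convMul_apply]
  simp [Coalgebra.Repr.tmul, Finset.sum_product]

theorem sum_right_counit_smul {a : H} {ι : Type*} (r : Coalgebra.Repr k a ι) :
    ∑ i ∈ r.index, Coalgebra.counit (R := k) (r.right i) • r.left i = a := by
  have := congrArg (TensorProduct.rid k H) (Coalgebra.sum_tmul_counit_eq (R := k) r)
  simpa only [map_sum, TensorProduct.rid_tmul, one_smul] using this

theorem pull12_mul (σ f : Form k H) (g h m : H) :
    (convPull (proj12 k H) σ * convPull (mul12 k H) f) ((g ⊗ₜ h) ⊗ₜ m) =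
      f ((σ.toH * mulConv k H) (g ⊗ₜ h) ⊗ₜ m) := by
  have rg := Coalgebra.Repr.arbitrary k g
  have rh := Coalgebra.Repr.arbitrary k h
  have rm := Coalgebra.Repr.arbitrary k m
  rw [conv_apply3 _ _ rg rh rm, conv_apply2 _ _ rg rh]
  simp only [convPull_apply, proj12_tmul, mul12_tmul, toH_apply, mulConv_tmul, sum_tmul,
    tmul_sum, map_sum, map_smul, smul_eq_mul, ← Algebra.smul_def,
    ← smul_tmul', tmul_smul]
  refine Finset.sum_congr rfl fun i _ => Finset.sum_congr rfl fun j _ => ?_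
  conv_rhs => rw [← Coalgebra.sum_counit_smul rm]
  simp only [sum_tmul, tmul_sum, map_sum, Finset.mul_sum, tmul_smul, ← smul_tmul', map_smul,
    smul_eq_mul]
  exact Finset.sum_congr rfl fun l _ => by ring

theorem mul_pull12 (σ f : Form k H) (g h m : H) :
    (convPull (mul12 k H) f * convPull (proj12 k H) σ) ((g ⊗ₜ h) ⊗ₜ m) =
      f ((mulConv k H * σ.toH) (g ⊗ₜ h) ⊗ₜ m) := by
  have rg := Coalgebra.Repr.arbitrary k g
  have rh := Coalgebra.Repr.arbitrary k h
  have rm := Coalgebra.Repr.arbitrary k m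
  rw [conv_apply3 _ _ rg rh rm, conv_apply2 _ _ rg rh]
  simp only [convPull_apply, proj12_tmul, mul12_tmul, toH_apply, mulConv_tmul, sum_tmul,
    tmul_sum, map_sum, map_smul, smul_eq_mul, ← Algebra.commutes, ← Algebra.smul_def,
    ← smul_tmul', tmul_smul]
  refine Finset.sum_congr rfl fun i _ => Finset.sum_congr rfl fun j _ => ?_
  conv_rhs => rw [← sum_right_counit_smul (k := k) rm]
  simp only [sum_tmul, tmul_sum, map_sum, Finset.mul_sum, tmul_smul, ← smul_tmul', map_smul,
    smul_eq_mul]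
  exact Finset.sum_congr rfl fun l _ => by ring

theorem pull23_mul (σ f : Form k H) (g h m : H) :
    (convPull (proj23 k H) σ * convPull (mul23 k H) f) ((g ⊗ₜ h) ⊗ₜ m) =
      f (g ⊗ₜ (σ.toH * mulConv k H) (h ⊗ₜ m)) := by
  have rg := Coalgebra.Repr.arbitrary k g
  have rh := Coalgebra.Repr.arbitrary k h
  have rm := Coalgebra.Repr.arbitrary k m
  rw [conv_apply3 _ _ rg rh rm, conv_apply2 _ _ rh rm]
  rw [Finset.sum_comm]
  simp_rw [Finset.sum_comm (s := rg.index)]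
  simp only [convPull_apply, proj23_tmul, mul23_tmul, toH_apply, mulConv_tmul, sum_tmul,
    tmul_sum, map_sum, map_smul, smul_eq_mul, ← Algebra.smul_def,
    ← smul_tmul', tmul_smul]
  refine Finset.sum_congr rfl fun i _ => Finset.sum_congr rfl fun j _ => ?_
  conv_rhs => rw [← Coalgebra.sum_counit_smul rg]
  simp only [sum_tmul, tmul_sum, map_sum, Finset.mul_sum, tmul_smul, ← smul_tmul', map_smul,
    smul_eq_mul]
  exact Finset.sum_congr rfl fun l _ => by ring

theorem mul_pull23 (σ f : Form k H) (g h m : H) :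
    (convPull (mul23 k H) f * convPull (proj23 k H) σ) ((g ⊗ₜ h) ⊗ₜ m) =
      f (g ⊗ₜ (mulConv k H * σ.toH) (h ⊗ₜ m)) := by
  have rg := Coalgebra.Repr.arbitrary k g
  have rh := Coalgebra.Repr.arbitrary k h
  have rm := Coalgebra.Repr.arbitrary k m
  rw [conv_apply3 _ _ rg rh rm, conv_apply2 _ _ rh rm]
  rw [Finset.sum_comm]
  simp_rw [Finset.sum_comm (s := rg.index)]
  simp only [convPull_apply, proj23_tmul, mul23_tmul, toH_apply, mulConv_tmul, sum_tmul,
    tmul_sum, map_sum, map_smul, smul_eq_mul, ← Algebra.commutes, ← Algebra.smul_def,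
    ← smul_tmul', tmul_smul]
  refine Finset.sum_congr rfl fun i _ => Finset.sum_congr rfl fun j _ => ?_
  conv_rhs => rw [← sum_right_counit_smul (k := k) rg]
  simp only [sum_tmul, tmul_sum, map_sum, Finset.mul_sum, tmul_smul, ← smul_tmul', map_smul,
    smul_eq_mul]
  exact Finset.sum_congr rfl fun l _ => by ring

theorem Form.ext3 {f f' : WithConv ((H ⊗[k] H) ⊗[k] H →ₗ[k] k)}
    (h : ∀ a b c : H, f ((a ⊗ₜ b) ⊗ₜ c) = f' ((a ⊗ₜ b) ⊗ₜ c)) : f = f' := by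
  refine WithConv.ext (TensorProduct.ext_threefold h)

theorem Form.isLeftCocycle_iff (σ : Form k H) : σ.IsLeftCocycle ↔
    convPull (proj12 k H) σ * convPull (mul12 k H) σ =
      convPull (proj23 k H) σ * convPull (mul23 k H) σ := by
  constructor
  · intro h
    refine Form.ext3 fun a b c => ?_
    rw [pull12_mul, pull23_mul, h]
  · intro h a b c
    rw [← pull12_mul, ← pull23_mul, h]

theorem Form.IsLazy.commute12 {σ : Form k H} (h : σ.IsLazy) (f : Form k H) :
    Commute (convPull (proj12 k H) σ) (convPull (mul12 k H) f) :=
  Form.ext3 fun a b c => by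
    rw [pull12_mul, mul_pull12, h]

theorem Form.IsLazy.commute23 {σ : Form k H} (h : σ.IsLazy) (f : Form k H) :
    Commute (convPull (proj23 k H) σ) (convPull (mul23 k H) f) :=
  Form.ext3 fun a b c => by
    rw [pull23_mul, mul_pull23, h]

variable (k H) in
/-- The group `Z_L(H)` of lazy (left) 2-cocycles: the convolution invertible `σ : H ⊗ H → k`
which are left cocycles and lazy, under the convolution product. -/
def lazyCocycles : Subgroup (Form k H)ˣ where
  carrier := {σ | (σ : Form k H).IsLeftCocycle ∧ (σ : Form k H).IsLazy}
  one_mem' := by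
    constructor
    · rw [Units.val_one, Form.isLeftCocycle_iff]
      simp only [map_one]
    · have : (1 : Form k H).toH = 1 := map_one (toHHom k H)
      simp [Form.IsLazy, this]
  mul_mem' := by
    rintro σ ω ⟨h1, h2⟩ ⟨h3, h4⟩
    rw [Form.isLeftCocycle_iff] at h1 h3
    refine ⟨?_, ?_⟩
    · rw [Form.isLeftCocycle_iff, Units.val_mul]
      simp only [map_mul]
      rw [(h4.commute12 _).mul_mul_mul_comm, (h4.commute23 _).mul_mul_mul_comm, h1, h3]
    · have : (σ * ω : Form k H).toH = (σ : Form k H).toH * (ω : Form k H).toH :=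
        map_mul (toHHom k H) _ _
      rw [Form.IsLazy, Units.val_mul, this]
      exact Commute.mul_left h2 h4
  inv_mem' := by
    rintro σ ⟨h1, h2⟩
    rw [Form.isLeftCocycle_iff] at h1
    refine ⟨?_, ?_⟩
    · rw [Form.isLeftCocycle_iff]
      have e12 := h2.commute12 σ
      have e23 := h2.commute23 σ
      rw [e12.eq, e23.eq] at h1
      have := congrArg Inv.inv (Units.ext h1 :
        Units.map (convPull (mul12 k H)) σ * Units.map (convPull (proj12 k H)) σ =
        Units.map (convPull (mul23 k H)) σ * Units.map (convPull (proj23 k H)) σ)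
      rw [mul_inv_rev, mul_inv_rev] at this
      exact congrArg Units.val this
    · exact Commute.units_inv_left (u := Units.map (toHHom k H) σ) h2

/-- The action `σ · r = (σ ∘ τ) * r * σ⁻¹` (convolution products) of invertible forms. -/
def twist (σ : (Form k H)ˣ) (r : Form k H) : Form k H :=
  (σ : Form k H).flip * r * ((σ⁻¹ : (Form k H)ˣ) : Form k H)

theorem flip_mul (σ ω : Form k H) : (σ * ω).flip = σ.flip * ω.flip :=
  map_mul (convPull (Bialgebra.TensorProduct.comm k H H : H ⊗[k] H →ₗc[k] H ⊗[k] H)) σ ω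

theorem twist_mul (σ ω : (Form k H)ˣ) (r : Form k H) : twist (σ * ω) r = twist σ (twist ω r) := by
  simp only [twist, Units.val_mul, flip_mul, mul_inv_rev, mul_assoc]

theorem twist_one (r : Form k H) : twist 1 r = r := by
  have : (1 : Form k H).flip = 1 :=
    map_one (convPull (Bialgebra.TensorProduct.comm k H H : H ⊗[k] H →ₗc[k] H ⊗[k] H))
  simp [twist, this]

/-- `s` lies in the orbit of `r` under the action of the group of lazy cocycles. -/
def SameLazyOrbit (r s : Form k H) : Prop :=
  ∃ σ ∈ lazyCocycles k H, twist σ r = s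

end Forms

/-! ## The coquasi-triangular structures `r_A` on `E(n)` -/

namespace HopfE

variable {k : Type*} [Field k] {n : ℕ}

/-- The element `u^* ⊗ v^*` of `(E(n) ⊗ E(n))^*`, for `u`, `v` in the basis `x_P`, `c x_P`. -/
def dualTensor (u v : Bool × Finset (Fin n)) : HopfE k n ⊗[k] HopfE k n →ₗ[k] k :=
  dualDistrib k _ _ ((basis k n).coord u ⊗ₜ (basis k n).coord v)

/-- `∑_η sign(η) a_{P, η(F)}` for `|F| = |P|`, where
`a_{P, η(F)} = a_{p_1, f_{η(1)}} ⋯ a_{p_s, f_{η(s)}}`. -/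
def minorSum (A : Matrix (Fin n) (Fin n) k) (P F : Finset (Fin n)) (h : F.card = P.card) : k :=
  ∑ η : Equiv.Perm (Fin P.card), ((Equiv.Perm.sign η : ℤ) : k) *
    ∏ t, A (P.orderEmbOfFin rfl t) (F.orderEmbOfFin h (η t))

/-- The form `r_A` on `E(n)` attached to a matrix `A`. -/
def rForm (A : Matrix (Fin n) (Fin n) k) : Form k (HopfE k n) :=
  toConv (∑ P : Finset (Fin n), (-1 : k) ^ (P.card * (P.card - 1) / 2) •
    ∑ F : Finset (Fin n), if h : F.card = P.card then
      minorSum A P F h •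
        (dualTensor (false, P) (false, F) + dualTensor (true, P) (false, F)
          + (-1 : k) ^ P.card • dualTensor (false, P) (true, F)
          - (-1 : k) ^ P.card • dualTensor (true, P) (true, F))
    else 0)

end HopfE

end

/-! In the convolution algebra $E(n)^*$ the character $\chi$ and the skew derivations $\xi_v$
satisfy the defining relations of $E(n)$. Hence for every $A$ there is an algebra map `rho A` from
$E(n)$ to $E(n)^*$ with $c\mapsto\chi$ and $x_i\mapsto\xi_{A_i}$, where $A_i$ is the $i$-th row. Its
form `bichar A` is multiplicative in the first variable by construction. Everything else is checked
on generators: a linear map on $E(n)$ is determined by its value at $1$ and by its translates under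
left multiplication by $c$ and the $x_i$, and `transC_mul`, `transX_mul` give the translates of a
convolution product. This yields multiplicativity in the second variable (`col_mul`), the
commutation rule (`toH_mul_mulConv`) and the inverse (`flip_bichar_mul_bichar`). On the basis,
`bichar A` is computed by Laplace expansion of minors, which identifies it with $r_A$
(`rForm_eq_bichar`).

Three facts give one direction of the orbit statement: (1) the flip of $r_A$ is $r_{A^T}^{-1}$; (2)
$r_A*r_B^{-1}*r_C=r_{A-B+C}$ (`bicharUnit_mul_inv_mul`); (3) on any bialgebra, $r^{-1}*s$ is a lazy
cocycle when $r,s$ are coquasi-triangular, by Yang–Baxter relations mixing $r$ and $s$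
(`inv_mul_mem_lazyCocycles`). If $A-B$ is symmetric, put $M=(A-B)/2$ and $\sigma=r_0^{-1}*r_M$. Then
$\sigma\cdot r_A=r_0*r_M^{-1}*r_A*r_M^{-1}*r_0=r_{A-2M}=r_B$. The characteristic matters only for
this halving.

Conversely, evaluating $(\sigma\tau)*r_A=r_B*\sigma$ at $x_i\otimes x_j$ gives
$\sigma(1\otimes1)(a_{ij}-b_{ij})=\sigma(x_i\otimes x_j)+\sigma(x_j\otimes x_i)$. The right side is
symmetric in $i,j$, and $\sigma(1\otimes 1)\ne0$. -/

noncomputable section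

/-! ### Convolution algebras: constants, currying, scalar-valued maps -/

section Convolution

variable {k : Type*} [Field k] {H : Type*} [Ring H] [Bialgebra k H] {A : Type*} [Ring A]
  [Algebra k A]

@[simp] theorem conv_neg_mul (f g : WithConv (H →ₗ[k] A)) : -f * g = -(f * g) := neg_mul f g

@[simp] theorem conv_mul_neg (f g : WithConv (H →ₗ[k] A)) : f * -g = -(f * g) := mul_neg f g

variable (k H) in
/-- The map `h ↦ ε(h) a`, as an element of a convolution algebra. -/
def constConv (a : A) : WithConv (H →ₗ[k] A) :=
  toConv (LinearMap.toSpanSingleton k A a ∘ₗ Coalgebra.counit)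

theorem constConv_apply (a : A) (h : H) :
    constConv k H a h = Coalgebra.counit (R := k) h • a := rfl

/-- Convolving with a constant is pointwise multiplication, so an equation `transC f = constConv k _
a * f` encodes the recursion $f(ch)=a f(h)$. -/
theorem constConv_mul_apply (a : A) (f : WithConv (H →ₗ[k] A)) (h : H) :
    (constConv k H a * f) h = a * f h := by
  have r := Coalgebra.Repr.arbitrary k h
  rw [r.convMul_apply]
  conv_rhs => rw [← Coalgebra.sum_counit_smul r]
  simp [constConv_apply, Finset.mul_sum]

theorem mul_constConv_apply (a : A) (f : WithConv (H →ₗ[k] A)) (h : H) :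
    (f * constConv k H a) h = f h * a := by
  have r := Coalgebra.Repr.arbitrary k h
  rw [r.convMul_apply]
  conv_rhs => rw [← sum_right_counit_smul r]
  simp [constConv_apply, Finset.sum_mul]

theorem constConv_mul (a b : A) : constConv k H (a * b) = constConv k H a * constConv k H b :=
  WithConv.ext <| LinearMap.ext fun h => by
    change _ = (constConv k H a * constConv k H b) h
    rw [constConv_mul_apply]
    simp [constConv_apply]

theorem constConv_one : constConv k H (1 : A) = 1 :=
  WithConv.ext <| LinearMap.ext fun h => by
    simp [constConv, LinearMap.convOne_def, Algebra.algebraMap_eq_smul_one]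

theorem constConv_neg (a : A) : constConv k H (-a) = -constConv k H a :=
  WithConv.ext <| LinearMap.ext fun h => by simp [constConv]

theorem constConv_zero : constConv k H (0 : A) = 0 :=
  WithConv.ext <| LinearMap.ext fun h => by simp [constConv]

theorem constConv_smul (s : k) (a : A) : constConv k H (s • a) = s • constConv k H a :=
  WithConv.ext <| LinearMap.ext fun h => by simp [constConv, smul_comm s]

theorem constConv_add (a b : A) : constConv k H (a + b) = constConv k H a + constConv k H b :=
  WithConv.ext <| LinearMap.ext fun h => by simp [constConv]

/-- The partial map `l ↦ F(h ⊗ l)`, as a convolution-algebra valued function of `h`. -/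
def curryConv (F : WithConv (H ⊗[k] H →ₗ[k] A)) : WithConv (H →ₗ[k] WithConv (H →ₗ[k] A)) :=
  toConv ((WithConv.linearEquiv k (H →ₗ[k] A)).symm.toLinearMap ∘ₗ TensorProduct.curry F.ofConv)

theorem curryConv_apply (F : WithConv (H ⊗[k] H →ₗ[k] A)) (h l : H) :
    curryConv F h l = F (h ⊗ₜ l) := rfl

theorem curryConv_injective : Function.Injective
    (curryConv : WithConv (H ⊗[k] H →ₗ[k] A) → WithConv (H →ₗ[k] WithConv (H →ₗ[k] A))) := by
  intro F G h
  refine WithConv.ext (TensorProduct.ext' fun a b => ?_)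
  exact congrArg (fun f : WithConv (H →ₗ[k] WithConv (H →ₗ[k] A)) => f a b) h

/-- The coproduct of $H\otimes H$ is formed factor by factor. Identities between forms thus become
identities between functions of the first variable with values in a convolution algebra, open to
induction on that variable. -/
theorem curryConv_mul (F G : WithConv (H ⊗[k] H →ₗ[k] A)) :
    curryConv (F * G) = curryConv F * curryConv G := by
  refine WithConv.ext (LinearMap.ext fun h => WithConv.ext (LinearMap.ext fun l => ?_))
  change (F * G) (h ⊗ₜ l) = (curryConv F * curryConv G) h l
  have rh := Coalgebra.Repr.arbitrary k h
  have rl := Coalgebra.Repr.arbitrary k l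
  rw [conv_apply2 F G rh rl, rh.convMul_apply]
  simp only [ofConv_sum, LinearMap.sum_apply]
  refine Finset.sum_congr rfl fun i _ => ?_
  rw [rl.convMul_apply]
  rfl

theorem curryConv_one : curryConv (1 : WithConv (H ⊗[k] H →ₗ[k] A)) = 1 := by
  refine WithConv.ext (LinearMap.ext fun h => WithConv.ext (LinearMap.ext fun l => ?_))
  change (1 : WithConv (H ⊗[k] H →ₗ[k] A)) (h ⊗ₜ l) = _
  simp [Algebra.algebraMap_eq_smul_one, LinearMap.convOne_def, smul_smul]
  rw [mul_comm]

/-- The form on `H ⊗ H` with given partial maps. -/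
def uncurryConv (φ : H →ₗ[k] WithConv (H →ₗ[k] A)) : WithConv (H ⊗[k] H →ₗ[k] A) :=
  toConv (TensorProduct.lift ((WithConv.linearEquiv k (H →ₗ[k] A)).toLinearMap ∘ₗ φ))

theorem curryConv_uncurryConv (φ : H →ₗ[k] WithConv (H →ₗ[k] A)) :
    curryConv (uncurryConv φ) = toConv φ := by
  refine WithConv.ext (LinearMap.ext fun h => WithConv.ext (LinearMap.ext fun l => ?_))
  simp [curryConv, uncurryConv]

variable (k H A) in
/-- Composition with the structure map `k → A`, as a map of convolution algebras. -/
def scalarConv : WithConv (H →ₗ[k] k) →ₐ[k] WithConv (H →ₗ[k] A) :=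
  AlgHom.ofLinearMap
    { toFun := fun f => toConv (Algebra.linearMap k A ∘ₗ f.ofConv)
      map_add' := fun f g => by simp [LinearMap.comp_add]
      map_smul' := fun s f => by simp [LinearMap.comp_smul] }
    (by ext a; simp [LinearMap.convOne_def])
    (fun f g => congrArg toConv (LinearMap.algHom_comp_convMul_distrib (Algebra.ofId k A) f g))

theorem scalarConv_apply (f : WithConv (H →ₗ[k] k)) (h : H) :
    (scalarConv k H A f).ofConv h = algebraMap k A (f h) := rfl

theorem scalarConv_commute_const (f : WithConv (H →ₗ[k] k)) (a : A) :
    Commute (scalarConv k H A f) (constConv k H a) :=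
  WithConv.ext <| LinearMap.ext fun h => by
    change (scalarConv k H A f * constConv k H a).ofConv h =
      (constConv k H a * scalarConv k H A f).ofConv h
    rw [mul_constConv_apply, constConv_mul_apply, scalarConv_apply, Algebra.commutes]

end Convolution

/-! ### Translation by the generators -/

namespace HopfE

variable {k : Type*} [Field k] {n : ℕ} {A : Type*} [Ring A] [Algebra k A]

theorem induction_left {P : HopfE k n → Prop} (h1 : P 1) (hc : ∀ a, P a → P (c k n * a))
    (hx : ∀ i a, P a → P (x k i * a)) (ha : ∀ a b, P a → P b → P (a + b))
    (hs : ∀ (s : k) a, P a → P (s • a)) (a : HopfE k n) : P a := by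
  suffices H : ∀ a b : HopfE k n, P b → P (a * b) by simpa using H a 1 h1
  intro a
  induction a using HopfE.induction with
  | hs s => intro b hb; rw [← Algebra.smul_def]; exact hs s b hb
  | hc => exact hc
  | hx i => exact hx i
  | hm a b h1 h2 => intro d hd; rw [mul_assoc]; exact h1 _ (h2 d hd)
  | ha a b h1 h2 => intro d hd; rw [add_mul]; exact ha _ _ (h1 d hd) (h2 d hd)

/-- Linear maps agreeing at `1` agree if agreement persists under left multiplication by the
generators. -/
theorem linearMap_ext {M : Type*} [AddCommGroup M] [Module k M] {f g : HopfE k n →ₗ[k] M}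
    (h1 : f 1 = g 1) (hc : ∀ a, f a = g a → f (c k n * a) = g (c k n * a))
    (hx : ∀ i a, f a = g a → f (x k i * a) = g (x k i * a)) : f = g :=
  LinearMap.ext fun a => by
    induction a using HopfE.induction_left with
    | h1 => exact h1
    | hc a ih => exact hc a ih
    | hx i a ih => exact hx i a ih
    | ha a b h1 h2 => rw [map_add, map_add, h1, h2]
    | hs s a h => rw [map_smul, map_smul, h]

/-- `h ↦ f(c h)`. -/
def transC (f : WithConv (HopfE k n →ₗ[k] A)) : WithConv (HopfE k n →ₗ[k] A) :=
  toConv (f.ofConv ∘ₗ LinearMap.mulLeft k (c k n))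

/-- `h ↦ f(x_i h)`. -/
def transX (i : Fin n) (f : WithConv (HopfE k n →ₗ[k] A)) : WithConv (HopfE k n →ₗ[k] A) :=
  toConv (f.ofConv ∘ₗ LinearMap.mulLeft k (x k i))

theorem transC_apply (f : WithConv (HopfE k n →ₗ[k] A)) (h : HopfE k n) :
    transC f h = f (c k n * h) := rfl

theorem transX_apply (i : Fin n) (f : WithConv (HopfE k n →ₗ[k] A)) (h : HopfE k n) :
    transX i f h = f (x k i * h) := rfl

theorem conv_ext {f g : WithConv (HopfE k n →ₗ[k] A)} (h : ∀ a, f a = g a) : f = g :=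
  WithConv.ext (LinearMap.ext h)

/-- This is $\Delta(c)=c\otimes c$ in dual form. -/
theorem transC_mul (f g : WithConv (HopfE k n →ₗ[k] A)) :
    transC (f * g) = transC f * transC g := by
  refine conv_ext fun h => ?_
  rw [transC_apply, LinearMap.convMul_apply, LinearMap.convMul_apply, Bialgebra.comul_mul,
    comul_eq _ _ (c k n), comulHom_c]
  generalize Coalgebra.comul (R := k) h = t
  induction t with
  | zero => simp
  | add a b h1 h2 => simp only [mul_add, map_add, h1, h2]
  | tmul a b => simp [transC]

/-- The twisted Leibniz rule dual to $\Delta(x_i)=1\otimes x_i+x_i\otimes c$; the term $x_i\otimes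
c$ puts `transC` on the second factor. -/
theorem transX_mul (i : Fin n) (f g : WithConv (HopfE k n →ₗ[k] A)) :
    transX i (f * g) = f * transX i g + transX i f * transC g := by
  refine conv_ext fun h => ?_
  change (f * g) (x k i * h) = (f * transX i g) h + (transX i f * transC g) h
  rw [LinearMap.convMul_apply, LinearMap.convMul_apply, LinearMap.convMul_apply,
    Bialgebra.comul_mul, comul_eq _ _ (x k i), comulHom_x]
  generalize Coalgebra.comul (R := k) h = t
  induction t with
  | zero => simp
  | add a b h1 h2 => simp only [mul_add, map_add, h1, h2]; abel
  | tmul a b => simp [transC, transX, add_mul]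

theorem conv_one_apply (f g : WithConv (HopfE k n →ₗ[k] A)) : (f * g) 1 = f 1 * g 1 := by
  simp [LinearMap.convMul_apply, Algebra.TensorProduct.one_def]

theorem transC_one : transC (1 : WithConv (HopfE k n →ₗ[k] A)) = 1 :=
  conv_ext fun h => by
    simp [transC, LinearMap.convOne_def, counit_eq]

theorem transX_one (i : Fin n) : transX i (1 : WithConv (HopfE k n →ₗ[k] A)) = 0 :=
  conv_ext fun h => by
    simp [transX, LinearMap.convOne_def, counit_eq]

theorem transC_constConv (a : A) : transC (constConv k (HopfE k n) a) = constConv k _ a :=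
  conv_ext fun h => by
    simp [transC, constConv, counit_eq]

theorem transX_constConv (i : Fin n) (a : A) : transX i (constConv k (HopfE k n) a) = 0 :=
  conv_ext fun h => by
    simp [transX, constConv, counit_eq]

@[simp] theorem transC_neg (f : WithConv (HopfE k n →ₗ[k] A)) : transC (-f) = -transC f := rfl
@[simp] theorem transC_add (f g : WithConv (HopfE k n →ₗ[k] A)) :
    transC (f + g) = transC f + transC g := rfl
@[simp] theorem transX_neg (i : Fin n) (f : WithConv (HopfE k n →ₗ[k] A)) :
    transX i (-f) = -transX i f := rfl
@[simp] theorem transX_add (i : Fin n) (f g : WithConv (HopfE k n →ₗ[k] A)) :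
    transX i (f + g) = transX i f + transX i g := rfl

/-- A functional killed by `1` and by left multiples of the `x_i`, and invariant under left
multiplication by `c`, vanishes. -/
theorem conv_eq_zero {f : WithConv (HopfE k n →ₗ[k] A)} (h1 : f 1 = 0) (hc : transC f = f)
    (hx : ∀ i, transX i f = 0) : f = 0 := by
  refine WithConv.ext (linearMap_ext h1 (fun a ha => ?_) (fun i a _ => ?_))
  · change transC f a = 0
    rw [hc]
    exact ha
  · change transX i f a = 0
    rw [hx]
    rfl

/-! ### The functionals `χ` and `ξ_v` -/

variable (k n) in
/-- The representation of `E(n)` by upper triangular matrices attached to a vector `v`. -/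
def triangular (v : Fin n → k) : HopfE k n →ₐ[k] Matrix (Fin 2) (Fin 2) k :=
  lift !![-1, 0; 0, 1] (fun i => !![0, v i; 0, 0])
    (by ext i j; fin_cases i <;> fin_cases j <;> simp)
    (fun i => by ext i j; fin_cases i <;> fin_cases j <;> simp)
    (fun i => by ext i j; fin_cases i <;> fin_cases j <;> simp)
    (fun i j _ => by ext i j; fin_cases i <;> fin_cases j <;> simp)

@[simp] theorem triangular_c (v : Fin n → k) : triangular k n v (c k n) = !![-1, 0; 0, 1] :=
  lift_c ..

@[simp] theorem triangular_x (v : Fin n → k) (i : Fin n) :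
    triangular k n v (x k i) = !![0, v i; 0, 0] := lift_x ..

variable (k n) in
/-- The character with `χ(c) = -1`, `χ(x_i) = 0`. -/
def chi : WithConv (HopfE k n →ₗ[k] k) :=
  toConv (Matrix.entryLinearMap k k (0 : Fin 2) (0 : Fin 2) ∘ₗ (triangular k n 0).toLinearMap)

/-- The skew derivation with `ξ_v(c) = 0`, `ξ_v(x_i) = v_i`. -/
def xi (v : Fin n → k) : WithConv (HopfE k n →ₗ[k] k) :=
  toConv (Matrix.entryLinearMap k k (0 : Fin 2) (1 : Fin 2) ∘ₗ (triangular k n v).toLinearMap)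

/-- The lower row $(0,\varepsilon(h))$ is the reason why translating $\xi_v$ by $x_i$ returns
$v_i\varepsilon$, the unit of $E(n)^*$ up to a scalar. -/
theorem triangular_one_one (v : Fin n → k) (h : HopfE k n) :
    triangular k n v h 1 0 = 0 ∧ triangular k n v h 1 1 = Coalgebra.counit (R := k) h := by
  induction h using HopfE.induction_left with
  | h1 => simp
  | hc a ih => simp [Matrix.mul_apply, Fin.sum_univ_two, ih, counit_eq]
  | hx i a ih => simp [Matrix.mul_apply, Fin.sum_univ_two, counit_eq]
  | ha a b h1 h2 => simp [h1, h2]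
  | hs s a h => simp [h]

@[simp] theorem chi_one : chi k n 1 = 1 := by simp [chi]

@[simp] theorem xi_one (v : Fin n → k) : xi v 1 = 0 := by simp [xi]

@[simp] theorem transC_chi : transC (chi k n) = -chi k n :=
  conv_ext fun h => by simp [transC, chi, Matrix.vecMul, dotProduct, Fin.sum_univ_two]

@[simp] theorem transX_chi (i : Fin n) : transX i (chi k n) = 0 :=
  conv_ext fun h => by simp [transX, chi, Matrix.vecMul, dotProduct, Fin.sum_univ_two]

@[simp] theorem transC_xi (v : Fin n → k) : transC (xi v) = -xi v :=
  conv_ext fun h => by simp [transC, xi, Matrix.vecMul, dotProduct, Fin.sum_univ_two]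

@[simp] theorem transX_xi (i : Fin n) (v : Fin n → k) : transX i (xi v) = v i • 1 :=
  conv_ext fun h => by
    simp [transX, xi, Matrix.vecMul, dotProduct, Fin.sum_univ_two, (triangular_one_one v h).2,
      LinearMap.convOne_def]

theorem chi_mul_chi : chi k n * chi k n = 1 := by
  rw [← sub_eq_zero]
  refine conv_eq_zero ?_ ?_ fun i => ?_
  · change (chi k n * chi k n) 1 - (1 : WithConv (HopfE k n →ₗ[k] k)) 1 = 0
    rw [conv_one_apply]
    simp [LinearMap.convOne_def]
  · simp [sub_eq_add_neg, transC_mul, transC_one]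
  · simp [sub_eq_add_neg, transX_mul, transX_one]

theorem chi_mul_xi (v : Fin n → k) : chi k n * xi v = -(xi v * chi k n) := by
  rw [← sub_eq_zero]
  refine conv_eq_zero ?_ ?_ fun i => ?_
  · change (chi k n * xi v) 1 - -(xi v * chi k n) 1 = 0
    rw [conv_one_apply, conv_one_apply]
    simp
  · simp [sub_eq_add_neg, transC_mul]
  · simp [sub_eq_add_neg, transX_mul]

theorem xi_mul_self (v : Fin n → k) : xi v * xi v = 0 := by
  refine conv_eq_zero ?_ ?_ fun i => ?_
  · rw [conv_one_apply]
    simp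
  · simp [transC_mul]
  · simp [transX_mul]

theorem xi_mul_xi (v w : Fin n → k) : xi v * xi w = -(xi w * xi v) := by
  rw [← sub_eq_zero]
  refine conv_eq_zero ?_ ?_ fun i => ?_
  · change (xi v * xi w) 1 - -(xi w * xi v) 1 = 0
    rw [conv_one_apply, conv_one_apply]
    simp
  · simp [sub_eq_add_neg, transC_mul]
  · simp [sub_eq_add_neg, transX_mul]

theorem xi_add (v w : Fin n → k) : xi (v + w) = xi v + xi w := by
  refine WithConv.ext (linearMap_ext ?_ (fun a ha => ?_) fun i a _ => ?_)
  · change xi (v + w) 1 = xi v 1 + xi w 1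
    simp
  · change transC (xi (v + w)) a = (transC (xi v) a) + (transC (xi w) a)
    have ha : xi (v + w) a = xi v a + xi w a := ha
    simp only [transC_xi, ofConv_neg, LinearMap.neg_apply, ha]
    abel
  · change transX i (xi (v + w)) a = (transX i (xi v) a) + (transX i (xi w) a)
    simp [add_mul]

theorem xi_smul (s : k) (v : Fin n → k) : xi (s • v) = s • xi v := by
  refine WithConv.ext (linearMap_ext ?_ (fun a ha => ?_) fun i a _ => ?_)
  · change xi (s • v) 1 = s * xi v 1
    simp
  · change transC (xi (s • v)) a = s * (transC (xi v) a)
    have ha : xi (s • v) a = s * xi v a := ha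
    simp only [transC_xi, ofConv_neg, LinearMap.neg_apply, ha]
    ring
  · change transX i (xi (s • v)) a = s * (transX i (xi v) a)
    simp [mul_assoc]

/-! ### The form `r_A` as a bicharacter -/

/-- The algebra map `E(n) → E(n)^*` with `c ↦ χ` and `x_i ↦ ξ_{A_i}`. -/
def rho (A : Matrix (Fin n) (Fin n) k) : HopfE k n →ₐ[k] WithConv (HopfE k n →ₗ[k] k) :=
  lift (chi k n) (fun i => xi (A i)) chi_mul_chi (fun _ => xi_mul_self _) (fun _ => chi_mul_xi _)
    (fun _ _ _ => xi_mul_xi _ _)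

@[simp] theorem rho_c (A : Matrix (Fin n) (Fin n) k) : rho A (c k n) = chi k n := lift_c ..

@[simp] theorem rho_x (A : Matrix (Fin n) (Fin n) k) (i : Fin n) : rho A (x k i) = xi (A i) :=
  lift_x ..

/-- `ρ_A` as an element of a convolution algebra. -/
def rhoConv (A : Matrix (Fin n) (Fin n) k) :
    WithConv (HopfE k n →ₗ[k] WithConv (HopfE k n →ₗ[k] k)) := toConv (rho A).toLinearMap

theorem rhoConv_apply (A : Matrix (Fin n) (Fin n) k) (h : HopfE k n) :
    rhoConv A h = rho A h := rfl

theorem transC_rhoConv (A : Matrix (Fin n) (Fin n) k) :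
    transC (rhoConv A) = constConv k _ (chi k n) * rhoConv A :=
  conv_ext fun h => by
    rw [constConv_mul_apply, transC_apply, rhoConv_apply, rhoConv_apply, map_mul, rho_c]

theorem transX_rhoConv (A : Matrix (Fin n) (Fin n) k) (i : Fin n) :
    transX i (rhoConv A) = constConv k _ (xi (A i)) * rhoConv A :=
  conv_ext fun h => by
    rw [constConv_mul_apply, transX_apply, rhoConv_apply, rhoConv_apply, map_mul, rho_x]

/-- The bicharacter on `E(n)` with `r(x_i ⊗ x_j) = a_{ij}`. -/
def bichar (A : Matrix (Fin n) (Fin n) k) : Form k (HopfE k n) :=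
  uncurryConv (rho A).toLinearMap

theorem curryConv_bichar (A : Matrix (Fin n) (Fin n) k) : curryConv (bichar A) = rhoConv A :=
  curryConv_uncurryConv _

theorem bichar_tmul (A : Matrix (Fin n) (Fin n) k) (h l : HopfE k n) :
    bichar A (h ⊗ₜ l) = (rho A h).ofConv l := by
  rw [← curryConv_apply, curryConv_bichar, rhoConv_apply]

end HopfE

section Convolution

variable {k : Type*} [Field k] {H : Type*} [Ring H] [Bialgebra k H] {A : Type*} [Ring A]
  [Algebra k A]

/-- The partial map `h ↦ F(h)(l)`. -/
def evalConv (F : WithConv (H →ₗ[k] WithConv (H →ₗ[k] A))) (l : H) : WithConv (H →ₗ[k] A) :=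
  toConv (LinearMap.applyₗ l ∘ₗ (WithConv.linearEquiv k (H →ₗ[k] A)).toLinearMap ∘ₗ F.ofConv)

theorem evalConv_apply (F : WithConv (H →ₗ[k] WithConv (H →ₗ[k] A))) (l h : H) :
    evalConv F l h = (F h).ofConv l := rfl

/-- Evaluating the inner variable at $l$ commutes with convolution by a scalar-valued factor. This
turns the translation formulas for `rho` into products of columns $r_A(\cdot\otimes l)$. -/
theorem mul_scalarConv_apply (F : WithConv (H →ₗ[k] WithConv (H →ₗ[k] k)))
    (f : WithConv (H →ₗ[k] k)) (h l : H) :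
    ((F * scalarConv k H (WithConv (H →ₗ[k] k)) f).ofConv h).ofConv l =
      (evalConv F l * f).ofConv h := by
  have r := Coalgebra.Repr.arbitrary k h
  rw [r.convMul_apply, r.convMul_apply]
  simp only [ofConv_sum, LinearMap.sum_apply]
  refine Finset.sum_congr rfl fun i _ => ?_
  rw [scalarConv_apply, evalConv_apply, ← Algebra.commutes, ← Algebra.smul_def, mul_comm]
  rfl

end Convolution

/-! ### The axioms of a coquasi-triangular structure for the bicharacter -/

namespace HopfE

variable {k : Type*} [Field k] {n : ℕ} {R : Type*} [Ring R] [Algebra k R]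

/-- Since $c$ and the $x_i$ generate, these recursions have at most one solution with a given value
at $1$. The inhomogeneous term `e` is nonzero only in the use for `xi_x_comm`. -/
theorem conv_ext_of_trans {f g : WithConv (HopfE k n →ₗ[k] R)} (a : R) (b : Fin n → R)
    (e : Fin n → WithConv (HopfE k n →ₗ[k] R)) (h1 : f 1 = g 1)
    (hcf : transC f = constConv k _ a * f) (hcg : transC g = constConv k _ a * g)
    (hxf : ∀ i, transX i f = constConv k _ (b i) * f + e i)
    (hxg : ∀ i, transX i g = constConv k _ (b i) * g + e i) : f = g := by
  refine WithConv.ext (linearMap_ext h1 (fun l hl => ?_) (fun i l hl => ?_))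
  · change transC f l = transC g l
    rw [hcf, hcg, constConv_mul_apply, constConv_mul_apply, hl]
  · change transX i f l = transX i g l
    rw [hxf, hxg]
    change (constConv k (HopfE k n) (b i) * f).ofConv l + e i l =
      (constConv k (HopfE k n) (b i) * g).ofConv l + e i l
    rw [constConv_mul_apply, constConv_mul_apply, hl]

theorem transC_scalarConv (f : WithConv (HopfE k n →ₗ[k] k)) :
    transC (scalarConv k (HopfE k n) R f) = scalarConv k (HopfE k n) R (transC f) := rfl

theorem transX_scalarConv (i : Fin n) (f : WithConv (HopfE k n →ₗ[k] k)) :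
    transX i (scalarConv k (HopfE k n) R f) = scalarConv k (HopfE k n) R (transX i f) := rfl

theorem scalarConv_neg' (f : WithConv (HopfE k n →ₗ[k] k)) :
    scalarConv k (HopfE k n) R (-f) = -scalarConv k (HopfE k n) R f := map_neg _ f

/-! ### Right multiplicativity -/

theorem rho_apply_one (A : Matrix (Fin n) (Fin n) k) (h : HopfE k n) :
    (rho A h).ofConv 1 = Coalgebra.counit (R := k) h := by
  induction h using HopfE.induction_left with
  | h1 => simp [LinearMap.convOne_def]
  | hc a ih => rw [map_mul, conv_one_apply, rho_c, ih]; simp [counit_eq]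
  | hx i a ih => rw [map_mul, conv_one_apply, rho_x]; simp [counit_eq]
  | ha a b h1 h2 => rw [map_add, map_add, ← h1, ← h2]; rfl
  | hs s a h => rw [map_smul, map_smul, ← h]; rfl

/-- Multiplicativity in the second variable for left multiplication by $c$: the column
$r_A(\cdot\otimes c)$ is $\chi$. -/
theorem transC_rho (A : Matrix (Fin n) (Fin n) k) (h : HopfE k n) :
    transC (rho A h) = (rhoConv A * scalarConv k _ _ (chi k n)).ofConv h := by
  induction h using HopfE.induction_left with
  | h1 =>
    rw [map_one, transC_one, conv_one_apply, rhoConv_apply, map_one, scalarConv_apply, chi_one,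
      map_one, one_mul]
  | hc a ih =>
    rw [map_mul, rho_c, transC_mul, ih, transC_chi, ← transC_apply, transC_mul, transC_rhoConv,
      transC_scalarConv, transC_chi, scalarConv_neg', conv_mul_neg, conv_neg_mul, mul_assoc]
    rw [ofConv_neg, LinearMap.neg_apply, constConv_mul_apply]
  | hx i a ih =>
    rw [map_mul, rho_x, transC_mul, ih, transC_xi, ← transX_apply, transX_mul, transX_rhoConv,
      transX_scalarConv, transX_chi, transC_scalarConv, transC_chi, map_zero, mul_zero, zero_add,
      scalarConv_neg', conv_mul_neg, conv_neg_mul, mul_assoc]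
    rw [ofConv_neg, LinearMap.neg_apply, constConv_mul_apply]
  | ha a b h1 h2 => rw [map_add, map_add, transC_add, h1, h2]
  | hs s a h => rw [map_smul, map_smul, ← h]; rfl

/-- The same for $x_j$. The column $r_A(\cdot\otimes x_j)$ is $\chi*\xi_w$ with $w$ the $j$-th
column of $A$; it takes the value $a_{ij}$ at $x_i$ and, unlike $\xi_w$ itself, is invariant under
left multiplication by $c$. -/
theorem transX_rho (A : Matrix (Fin n) (Fin n) k) (j : Fin n) (h : HopfE k n) :
    transX j (rho A h) =
      (rhoConv A * scalarConv k _ _ (chi k n * xi (A.transpose j))).ofConv h := by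
  induction h using HopfE.induction_left with
  | h1 =>
    rw [map_one, transX_one, conv_one_apply, rhoConv_apply, map_one, scalarConv_apply,
      conv_one_apply, xi_one, mul_zero, map_zero, mul_zero]
  | hc a ih =>
    rw [map_mul, rho_c, transX_mul, ih, transX_chi, zero_mul, add_zero, ← transC_apply, transC_mul,
      transC_rhoConv, transC_scalarConv, transC_mul, transC_chi, transC_xi, conv_neg_mul,
      conv_mul_neg, neg_neg, mul_assoc, constConv_mul_apply]
  | hx i a ih =>
    have e : transX i (chi k n * xi (A.transpose j)) = A i j • chi k n := by
      rw [transX_mul, transX_chi, transX_xi, zero_mul, add_zero, mul_smul_comm, mul_one]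
      rfl
    have e' : transC (chi k n * xi (A.transpose j)) = chi k n * xi (A.transpose j) := by
      rw [transC_mul, transC_chi, transC_xi, conv_neg_mul, conv_mul_neg, neg_neg]
    rw [map_mul, rho_x, transX_mul, ih, transX_xi, transC_rho, smul_mul_assoc, one_mul,
      ← transX_apply, transX_mul, transX_scalarConv, e, transX_rhoConv, transC_scalarConv, e',
      map_smul, mul_smul_comm, mul_assoc, add_comm]
    rw [ofConv_add, LinearMap.add_apply, ofConv_smul, LinearMap.smul_apply, constConv_mul_apply]
  | ha a b h1 h2 => rw [map_add, map_add, transX_add, h1, h2]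
  | hs s a h => rw [map_smul, map_smul, ← h]; rfl

/-- The partial map `h ↦ r_A(h ⊗ l)`. -/
def col (A : Matrix (Fin n) (Fin n) k) (l : HopfE k n) : WithConv (HopfE k n →ₗ[k] k) :=
  evalConv (rhoConv A) l

theorem col_apply (A : Matrix (Fin n) (Fin n) k) (l h : HopfE k n) :
    col A l h = (rho A h).ofConv l := rfl

theorem col_one (A : Matrix (Fin n) (Fin n) k) : col A 1 = 1 :=
  conv_ext fun h => rho_apply_one A h

theorem col_c_mul (A : Matrix (Fin n) (Fin n) k) (l : HopfE k n) :
    col A (c k n * l) = col A l * chi k n :=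
  conv_ext fun h => by
    rw [col_apply, ← transC_apply, transC_rho, mul_scalarConv_apply, col]

theorem col_x_mul (A : Matrix (Fin n) (Fin n) k) (j : Fin n) (l : HopfE k n) :
    col A (x k j * l) = col A l * (chi k n * xi (A.transpose j)) :=
  conv_ext fun h => by
    rw [col_apply, ← transX_apply, transX_rho, mul_scalarConv_apply, col]

theorem col_add (A : Matrix (Fin n) (Fin n) k) (l m : HopfE k n) :
    col A (l + m) = col A l + col A m :=
  conv_ext fun h => by simp [col_apply]

theorem col_smul (A : Matrix (Fin n) (Fin n) k) (s : k) (l : HopfE k n) :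
    col A (s • l) = s • col A l :=
  conv_ext fun h => by simp [col_apply]

theorem col_mul (A : Matrix (Fin n) (Fin n) k) (g l : HopfE k n) :
    col A (g * l) = col A l * col A g := by
  induction g using HopfE.induction_left with
  | h1 => rw [one_mul, col_one, mul_one]
  | hc a ih => rw [mul_assoc, col_c_mul, col_c_mul, ih, mul_assoc]
  | hx i a ih => rw [mul_assoc, col_x_mul, col_x_mul, ih, mul_assoc]
  | ha a b h1 h2 => rw [add_mul, col_add, col_add, h1, h2, mul_add]
  | hs s a h => rw [smul_mul_assoc, col_smul, col_smul, h, mul_smul_comm]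

/-! ### Invertibility -/

theorem curryConv_flip_bichar (A : Matrix (Fin n) (Fin n) k) (h : HopfE k n) :
    curryConv (bichar A).flip h = col A h :=
  conv_ext fun l => bichar_tmul A l h

/-- Translating the product by $c$ inserts $\chi*\chi=1$ between the two factors, and translating by
$x_i$ inserts $\xi+\chi*\xi*\chi=0$. The product therefore obeys the recursion of the unit. -/
theorem flip_bichar_mul_bichar (A : Matrix (Fin n) (Fin n) k) :
    (bichar A).flip * bichar A.transpose = 1 := by
  apply curryConv_injective
  rw [curryConv_mul, curryConv_bichar, curryConv_one]
  have hC : transC (curryConv (bichar A).flip) =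
      curryConv (bichar A).flip * constConv k _ (chi k n) := conv_ext fun h => by
    rw [mul_constConv_apply, transC_apply, curryConv_flip_bichar, curryConv_flip_bichar, col_c_mul]
  have hX (i : Fin n) : transX i (curryConv (bichar A).flip) =
      curryConv (bichar A).flip * constConv k _ (chi k n * xi (A.transpose i)) :=
    conv_ext fun h => by
      rw [mul_constConv_apply, transX_apply, curryConv_flip_bichar, curryConv_flip_bichar,
        col_x_mul]
  refine conv_ext_of_trans 1 0 0 ?_ ?_ ?_ (fun i => ?_) (fun i => ?_)
  · rw [conv_one_apply, curryConv_flip_bichar, col_one, rhoConv_apply, map_one, one_mul]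
    simp [LinearMap.convOne_def]
  · rw [transC_mul, hC, transC_rhoConv, mul_assoc, ← mul_assoc (constConv k _ _), ← constConv_mul,
      chi_mul_chi, constConv_one, one_mul, one_mul]
  · rw [transC_one, constConv_one, one_mul]
  · rw [transX_mul, hX, transX_rhoConv, transC_rhoConv, mul_assoc, ← mul_assoc (constConv k _ _),
      ← constConv_mul, chi_mul_xi, conv_neg_mul, mul_assoc (xi _), chi_mul_chi, mul_one,
      constConv_neg, conv_neg_mul, conv_mul_neg, add_neg_cancel]
    simp [constConv]
  · rw [transX_one]
    simp [constConv]

theorem flip_flip {H : Type*} [Ring H] [Bialgebra k H] (r : Form k H) : r.flip.flip = r :=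
  WithConv.ext (TensorProduct.ext' fun _ _ => rfl)

theorem flip_one {H : Type*} [Ring H] [Bialgebra k H] : (1 : Form k H).flip = 1 :=
  map_one (convPull (Bialgebra.TensorProduct.comm k H H : H ⊗[k] H →ₗc[k] H ⊗[k] H))

theorem bichar_mul_flip_bichar (A : Matrix (Fin n) (Fin n) k) :
    bichar A.transpose * (bichar A).flip = 1 := by
  have := congrArg Form.flip (flip_bichar_mul_bichar A.transpose)
  rwa [flip_mul, flip_flip, flip_one, Matrix.transpose_transpose] at this

theorem isUnit_bichar (A : Matrix (Fin n) (Fin n) k) : IsUnit (bichar A) := by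
  have h1 := flip_bichar_mul_bichar A.transpose
  have h2 := bichar_mul_flip_bichar A.transpose
  rw [Matrix.transpose_transpose] at h1 h2
  exact ⟨⟨_, _, h2, h1⟩, rfl⟩

/-! ### Almost commutativity -/

theorem scalarConv_mul_const (f : WithConv (HopfE k n →ₗ[k] k)) (a : R) :
    scalarConv k _ R f * constConv k _ a = constConv k _ a * scalarConv k _ R f :=
  scalarConv_commute_const f a

theorem scalarConv_mul_const_assoc (f : WithConv (HopfE k n →ₗ[k] k)) (a : R)
    (g : WithConv (HopfE k n →ₗ[k] R)) :
    scalarConv k _ R f * (constConv k _ a * g) = constConv k _ a * (scalarConv k _ R f * g) := by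
  rw [← mul_assoc, scalarConv_mul_const, mul_assoc]

variable (k n) in
/-- The identity map, as an element of the convolution algebra. -/
def idConv : WithConv (HopfE k n →ₗ[k] HopfE k n) := toConv LinearMap.id

theorem transC_idConv : transC (idConv k n) = constConv k _ (c k n) * idConv k n :=
  conv_ext fun h => by rw [constConv_mul_apply]; rfl

theorem transX_idConv (i : Fin n) : transX i (idConv k n) = constConv k _ (x k i) * idConv k n :=
  conv_ext fun h => by rw [constConv_mul_apply]; rfl

theorem idConv_one : idConv k n 1 = 1 := rfl

/-- The commutation axiom for $h=c$: $\sum\chi(l_1)\,c\,l_2=\sum l_1\,c\,\chi(l_2)$. -/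
theorem chi_c_comm :
    scalarConv k _ _ (chi k n) * constConv k _ (c k n) * idConv k n =
      idConv k n * (constConv k _ (c k n) * scalarConv k _ _ (chi k n)) := by
  refine conv_ext_of_trans (-c k n) (fun i => -x k i) 0 ?_ ?_ ?_ (fun i => ?_) (fun i => ?_)
  · rw [conv_one_apply, conv_one_apply, conv_one_apply, conv_one_apply, scalarConv_apply,
      idConv_one, chi_one, map_one]
    simp
  · simp only [transC_mul, transC_scalarConv, transC_chi, transC_constConv, transC_idConv,
      scalarConv_neg', constConv_neg, conv_neg_mul, conv_mul_neg, mul_assoc, scalarConv_mul_const_assoc]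
  · simp only [transC_mul, transC_scalarConv, transC_chi, transC_constConv, transC_idConv,
      scalarConv_neg', constConv_neg, conv_neg_mul, conv_mul_neg, mul_assoc]
  · simp only [transX_mul, transX_scalarConv, transX_chi, transX_constConv, transX_idConv,
      map_zero, zero_mul, add_zero, constConv_neg, conv_neg_mul, mul_assoc, scalarConv_mul_const_assoc, Pi.zero_apply]
    rw [← mul_assoc, ← constConv_mul, c_mul_x, constConv_neg, constConv_mul, conv_neg_mul, mul_assoc]
  · simp only [transX_mul, transX_scalarConv, transX_chi, transX_constConv, transX_idConv,
      transC_constConv, map_zero, zero_mul, add_zero, mul_zero, zero_add, transC_mul,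
      transC_scalarConv, transC_chi, scalarConv_neg',
      constConv_neg, conv_neg_mul, conv_mul_neg, mul_assoc, Pi.zero_apply]

/-- The commutation axiom for $h=x_i$; the two summands on each side come from $\Delta(x_i)=1\otimes
x_i+x_i\otimes c$. -/
theorem xi_x_comm (v : Fin n → k) (i : Fin n) :
    (constConv k _ (x k i) + scalarConv k _ _ (xi v) * constConv k _ (c k n)) * idConv k n =
      idConv k n * (scalarConv k _ _ (xi v) +
        constConv k _ (x k i) * scalarConv k _ _ (chi k n)) := by
  have hcc (f : WithConv (HopfE k n →ₗ[k] HopfE k n)) :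
      constConv k _ (c k n) * (constConv k _ (c k n) * f) = f := by
    rw [← mul_assoc, ← constConv_mul, c_mul_c, constConv_one, one_mul]
  have hxc (j : Fin n) (f : WithConv (HopfE k n →ₗ[k] HopfE k n)) :
      constConv k _ (x k j) * (constConv k _ (c k n) * f) =
        -(constConv k _ (c k n) * (constConv k _ (x k j) * f)) := by
    rw [← mul_assoc, ← constConv_mul, ← mul_assoc, ← constConv_mul, c_mul_x, constConv_neg,
      conv_neg_mul, neg_neg]
  have hxx (j : Fin n) (f : WithConv (HopfE k n →ₗ[k] HopfE k n)) :
      constConv k _ (x k i) * (constConv k _ (x k j) * f) =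
        -(constConv k _ (x k j) * (constConv k _ (x k i) * f)) := by
    rw [← mul_assoc, ← constConv_mul, ← mul_assoc, ← constConv_mul, x_mul_x i j, constConv_neg,
      conv_neg_mul]
  have hs (s : k) : scalarConv k _ (HopfE k n) (s • (1 : WithConv (HopfE k n →ₗ[k] k))) = s • 1 := by
    rw [map_smul, map_one]
  refine conv_ext_of_trans (-c k n) (fun i => -x k i) (fun j => v j • idConv k n)
    ?_ ?_ ?_ (fun j => ?_) (fun j => ?_)
  · rw [conv_one_apply, conv_one_apply, ofConv_add, ofConv_add, LinearMap.add_apply,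
      LinearMap.add_apply, conv_one_apply, conv_one_apply, scalarConv_apply, scalarConv_apply,
      idConv_one, chi_one, xi_one]
    simp
  · simp only [transC_mul, transC_add, transC_scalarConv, transC_xi, transC_constConv,
      transC_idConv, scalarConv_neg', constConv_neg, conv_neg_mul, conv_mul_neg, mul_assoc, add_mul, mul_add,
      scalarConv_mul_const_assoc, hcc, hxc]
  · simp only [transC_mul, transC_add, transC_scalarConv, transC_xi, transC_chi, transC_constConv,
      transC_idConv, scalarConv_neg', constConv_neg, conv_neg_mul, conv_mul_neg, mul_assoc,
      mul_add]
  · simp only [transX_mul, transX_add, transX_scalarConv, transX_xi, transX_constConv,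
      transX_idConv, transC_idConv, hs, smul_mul_assoc, one_mul, add_zero,
      constConv_neg, conv_neg_mul, mul_assoc, add_mul, mul_add, zero_mul,
      scalarConv_mul_const_assoc, hxx]
    rw [hxc j, neg_neg, mul_smul_comm, hcc, add_assoc]
  · simp only [transX_mul, transX_add, transX_scalarConv, transX_xi, transX_chi, transX_constConv,
      transX_idConv, transC_mul, transC_scalarConv, transC_xi, transC_chi,
      transC_constConv, hs, mul_smul_comm, mul_one, map_zero, scalarConv_neg',
      constConv_neg, conv_neg_mul, conv_mul_neg, mul_assoc, mul_add, zero_mul, mul_zero,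
      add_zero, zero_add]
    rw [add_assoc, add_comm]

theorem curryConv_toH_apply (A : Matrix (Fin n) (Fin n) k) (h : HopfE k n) :
    curryConv (bichar A).toH h = scalarConv k _ _ (rho A h) :=
  conv_ext fun l => by
    rw [curryConv_apply, toH_apply, scalarConv_apply, bichar_tmul]

theorem curryConv_mulConv_apply (h : HopfE k n) :
    curryConv (mulConv k (HopfE k n)) h = constConv k _ h * idConv k n :=
  conv_ext fun l => by
    rw [curryConv_apply, mulConv_tmul, constConv_mul_apply]
    rfl

theorem curryConv_mulOpConv_apply (h : HopfE k n) :
    curryConv (mulOpConv k (HopfE k n)) h = idConv k n * constConv k _ h :=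
  conv_ext fun l => by
    rw [curryConv_apply, mul_constConv_apply]
    rfl

variable (k n) in
/-- `h ↦ (l ↦ ε(l) h)`. -/
def constMap : WithConv (HopfE k n →ₗ[k] WithConv (HopfE k n →ₗ[k] HopfE k n)) :=
  toConv
    { toFun := fun h => constConv k _ h
      map_add' := constConv_add
      map_smul' := fun s a => conv_ext fun h => by simp [constConv, smul_comm s] }

theorem constMap_apply (h : HopfE k n) : constMap k n h = constConv k _ h := rfl

theorem toH_mul_mulConv (A : Matrix (Fin n) (Fin n) k) :
    (bichar A).toH * mulConv k (HopfE k n) = mulOpConv k (HopfE k n) * (bichar A).toH := by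
  apply curryConv_injective
  rw [curryConv_mul, curryConv_mul]
  set S := curryConv (bichar A).toH with hS
  set M := curryConv (mulConv k (HopfE k n)) with hM
  -- Splitting off the constant factor `idConv` leaves `constMap`, which satisfies left recursions
  -- of the same shape as those of `S` and `M`.
  have hN : curryConv (mulOpConv k (HopfE k n)) = constConv k _ (idConv k n) * constMap k n :=
    conv_ext fun h => by
      rw [curryConv_mulOpConv_apply, constConv_mul_apply, constMap_apply]
  have SC : transC S = constConv k _ (scalarConv k _ _ (chi k n)) * S := conv_ext fun h => by
    rw [transC_apply, constConv_mul_apply, hS, curryConv_toH_apply, curryConv_toH_apply, map_mul,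
      map_mul, rho_c]
  have SX (i : Fin n) : transX i S = constConv k _ (scalarConv k _ _ (xi (A i))) * S :=
    conv_ext fun h => by
      rw [transX_apply, constConv_mul_apply, hS, curryConv_toH_apply, curryConv_toH_apply, map_mul,
        map_mul, rho_x]
  have MC : transC M = constConv k _ (constConv k _ (c k n)) * M := conv_ext fun h => by
    rw [transC_apply, constConv_mul_apply, hM, curryConv_mulConv_apply, curryConv_mulConv_apply,
      constConv_mul, mul_assoc]
  have MX (i : Fin n) : transX i M = constConv k _ (constConv k _ (x k i)) * M :=
    conv_ext fun h => by
      rw [transX_apply, constConv_mul_apply, hM, curryConv_mulConv_apply, curryConv_mulConv_apply,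
        constConv_mul, mul_assoc]
  have KC : transC (constMap k n) = constConv k _ (constConv k _ (c k n)) * constMap k n :=
    conv_ext fun h => by
      rw [transC_apply, constConv_mul_apply, constMap_apply, constMap_apply, constConv_mul]
  have KX (i : Fin n) :
      transX i (constMap k n) = constConv k _ (constConv k _ (x k i)) * constMap k n :=
    conv_ext fun h => by
      rw [transX_apply, constConv_mul_apply, constMap_apply, constMap_apply, constConv_mul]
  have comS (a : HopfE k n) (f : WithConv (HopfE k n →ₗ[k] WithConv (HopfE k n →ₗ[k] HopfE k n))) :
      S * (constConv k _ (constConv k _ a) * f) = constConv k _ (constConv k _ a) * (S * f) := by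
    have : S * constConv k _ (constConv k _ a) = constConv k _ (constConv k _ a) * S := by
      refine conv_ext fun h => ?_
      rw [mul_constConv_apply, constConv_mul_apply, hS, curryConv_toH_apply, scalarConv_mul_const]
    rw [← mul_assoc, this, mul_assoc]
  have comK (f : WithConv (HopfE k n →ₗ[k] k))
      (g : WithConv (HopfE k n →ₗ[k] WithConv (HopfE k n →ₗ[k] HopfE k n))) :
      constMap k n * (constConv k _ (scalarConv k _ _ f) * g) =
        constConv k _ (scalarConv k _ _ f) * (constMap k n * g) := by
    have : constMap k n * constConv k _ (scalarConv k _ _ f) =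
        constConv k _ (scalarConv k _ _ f) * constMap k n := by
      refine conv_ext fun h => ?_
      rw [mul_constConv_apply, constConv_mul_apply, constMap_apply, scalarConv_mul_const]
    rw [← mul_assoc (constMap k n) _ g, this]
    exact mul_assoc (constConv k _ (scalarConv k _ _ f)) _ g
  have LC : transC (S * M) =
      constConv k _ (scalarConv k _ _ (chi k n) * constConv k _ (c k n)) * (S * M) := by
    rw [transC_mul, SC, MC, mul_assoc, comS, constConv_mul, mul_assoc]
  have LX (i : Fin n) : transX i (S * M) =
      constConv k _ (constConv k _ (x k i) +
        scalarConv k _ _ (xi (A i)) * constConv k _ (c k n)) * (S * M) := by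
    rw [transX_mul, SX, MX, MC, mul_assoc, comS, comS, constConv_add, constConv_mul, add_mul,
      mul_assoc]
  have RC : transC (constMap k n * S) =
      constConv k _ (constConv k _ (c k n) * scalarConv k _ _ (chi k n)) * (constMap k n * S) := by
    rw [transC_mul, SC, KC, mul_assoc, comK, constConv_mul, mul_assoc]
  have RX (i : Fin n) : transX i (constMap k n * S) =
      constConv k _ (scalarConv k _ _ (xi (A i)) +
        constConv k _ (x k i) * scalarConv k _ _ (chi k n)) * (constMap k n * S) := by
    rw [transX_mul, SX, SC, KX, mul_assoc, comK, comK, constConv_add, constConv_mul, add_mul,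
      mul_assoc]
  rw [hN, mul_assoc]
  -- Induction on the first variable: each generator multiplies the left side by its own expression,
  -- which `chi_c_comm` or `xi_x_comm` then carries across `idConv`.
  refine WithConv.ext (linearMap_ext ?_ (fun a ha => ?_) (fun i a ha => ?_))
  · rw [conv_one_apply, constConv_mul_apply, conv_one_apply, hS, hM, curryConv_toH_apply,
      curryConv_mulConv_apply, constMap_apply, map_one, map_one, constConv_one, one_mul, one_mul,
      mul_one, mul_one]
  · change (transC (S * M)).ofConv a =
      (constConv k _ (idConv k n) * (constMap k n * S)).ofConv (c k n * a)
    rw [LC, constConv_mul_apply, ha, constConv_mul_apply, constConv_mul_apply,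
      ← transC_apply (constMap k n * S), RC, constConv_mul_apply, ← mul_assoc, chi_c_comm, mul_assoc]
  · change (transX i (S * M)).ofConv a =
      (constConv k _ (idConv k n) * (constMap k n * S)).ofConv (x k i * a)
    rw [LX, constConv_mul_apply, ha, constConv_mul_apply, constConv_mul_apply,
      ← transX_apply i (constMap k n * S), RX, constConv_mul_apply, ← mul_assoc, xi_x_comm,
      mul_assoc]

theorem isCoquasitriangular_bichar (A : Matrix (Fin n) (Fin n) k) :
    (bichar A).IsCoquasitriangular where
  isUnit := isUnit_bichar A
  mul_left h g l := by
    have e (h : HopfE k n) : toConv ((bichar A).ofConv ∘ₗ TensorProduct.mk k _ _ h) = rho A h :=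
      conv_ext fun l => bichar_tmul A h l
    rw [e, e, bichar_tmul, map_mul]
  mul_right h g l := by
    have e (l : HopfE k n) :
        toConv ((bichar A).ofConv ∘ₗ (TensorProduct.mk k _ _).flip l) = col A l :=
      conv_ext fun h => bichar_tmul A h l
    rw [e, e, bichar_tmul, ← col_apply, col_mul]
  comm := toH_mul_mulConv A

/-! ### Additivity -/

theorem add_neg_add_neg {M : Type*} [AddCommGroup M] (a b d : M) : a + -(b + -d) = a + -b + d := by
  abel

set_option maxHeartbeats 1000000 in
-- The factor is $e=1-\xi_u\otimes(\chi*\xi_w)$. Translating by $x_i$ differentiates $\xi_u$ and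
-- produces the extra term $u_i\xi_w$, so that $e*r_A$ satisfies the recursion of `rho` for the rows
-- $A_i+u_iw$.
theorem exists_mul_bichar_of_rank_one (u w : Fin n → k) :
    ∃ e : Form k (HopfE k n), ∀ A : Matrix (Fin n) (Fin n) k,
      e * bichar A = bichar (A + Matrix.vecMulVec u w) := by
  let E := scalarConv k (HopfE k n) (WithConv (HopfE k n →ₗ[k] k)) (xi u) *
    constConv k _ (chi k n * xi w)
  refine ⟨1 - uncurryConv E.ofConv, fun A => ?_⟩
  apply curryConv_injective
  have hE : curryConv (1 - uncurryConv E.ofConv) = 1 + -E := by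
    have : curryConv (1 - uncurryConv E.ofConv) = curryConv 1 + -curryConv (uncurryConv E.ofConv) := by
      rw [← sub_eq_add_neg]; rfl
    rw [this, curryConv_one, curryConv_uncurryConv]
  rw [curryConv_mul, hE, curryConv_bichar, curryConv_bichar, add_mul, one_mul, conv_neg_mul]
  have hA (i : Fin n) : xi ((A + Matrix.vecMulVec u w) i) = xi (A i) + u i • xi w := by
    rw [← xi_smul, ← xi_add]
    rfl
  set R := rhoConv A with hR
  have hKc : chi k n * xi w * chi k n = -xi w := by
    rw [chi_mul_xi, conv_neg_mul, mul_assoc, chi_mul_chi, mul_one]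
  have hcK : chi k n * (chi k n * xi w) = xi w := by
    rw [← mul_assoc, chi_mul_chi, one_mul]
  have hKx (v : Fin n → k) : chi k n * xi w * xi v = xi v * (chi k n * xi w) := by
    rw [mul_assoc, xi_mul_xi w v, conv_mul_neg, ← mul_assoc, chi_mul_xi, conv_neg_mul, neg_neg,
      mul_assoc]
  have hxK : xi w * (chi k n * xi w) = 0 := by
    rw [← hKx, mul_assoc, xi_mul_self, mul_zero]
  have move {a b : WithConv (HopfE k n →ₗ[k] k)} (h : chi k n * xi w * a = b * (chi k n * xi w))
      (F : WithConv (HopfE k n →ₗ[k] WithConv (HopfE k n →ₗ[k] k))) :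
      E * (constConv k _ a * F) = constConv k _ b * (E * F) := by
    rw [mul_assoc, ← mul_assoc (constConv k _ _), ← constConv_mul, h, constConv_mul, mul_assoc,
      scalarConv_mul_const_assoc, mul_assoc]
  -- The quadratic term vanishes because $\xi_w*\chi*\xi_w=0$; this is where rank one is needed.
  have kill : constConv k _ (xi w) * (E * R) = 0 := by
    rw [mul_assoc, ← scalarConv_mul_const_assoc, ← mul_assoc (constConv k _ _), ← constConv_mul,
      hxK, constConv_zero, zero_mul, mul_zero]
  have kill' (s : k) : s • (constConv k _ (xi w) * (E * R)) = 0 := by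
    rw [kill]
    exact conv_ext fun h => by simp
  have EC : transC E = -E := by
    rw [transC_mul, transC_scalarConv, transC_xi, scalarConv_neg', transC_constConv, conv_neg_mul]
  have EX (i : Fin n) : transX i E = u i • constConv k _ (chi k n * xi w) := by
    rw [transX_mul, transX_constConv, mul_zero, zero_add, transX_scalarConv, transX_xi, map_smul,
      map_one, transC_constConv, smul_mul_assoc, one_mul]
  refine conv_ext_of_trans (chi k n) (fun i => xi ((A + Matrix.vecMulVec u w) i)) 0
    ?_ ?_ (transC_rhoConv _) (fun i => ?_) (fun i => ?_)
  · have : (E * R) 1 = 0 := by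
      rw [conv_one_apply, conv_one_apply, scalarConv_apply, xi_one, map_zero, zero_mul, zero_mul]
    rw [ofConv_add, LinearMap.add_apply, ofConv_neg, LinearMap.neg_apply, this, hR, rhoConv_apply,
      rhoConv_apply, map_one, map_one, neg_zero, add_zero]
  · have h : chi k n * xi w * chi k n = -chi k n * (chi k n * xi w) := by
      rw [hKc, conv_neg_mul, hcK]
    rw [transC_add, transC_neg, transC_mul, EC, hR, transC_rhoConv, conv_neg_mul, move h,
      constConv_neg, conv_neg_mul, neg_neg, mul_add, conv_mul_neg]
  · rw [transX_add, transX_neg, transX_mul, EX, hR, transX_rhoConv, transC_rhoConv, move (hKx _),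
      smul_mul_assoc, ← mul_assoc (constConv k _ _) (constConv k _ _), ← constConv_mul, hKc,
      constConv_neg, conv_neg_mul, hA, constConv_add, constConv_smul, add_mul, mul_add,
      mul_add, conv_mul_neg, conv_mul_neg, smul_mul_assoc, smul_mul_assoc, kill', neg_zero, smul_neg, add_zero, Pi.zero_apply, add_zero]
    exact add_neg_add_neg _ _ _
  · rw [transX_rhoConv, Pi.zero_apply, add_zero]

/-- The factor does not depend on $A$, so factors for $D$ and $D'$ compose to one for $D+D'$, and
single-entry matrices have the rank one form. -/
theorem exists_mul_bichar (D : Matrix (Fin n) (Fin n) k) :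
    ∃ e : Form k (HopfE k n), ∀ A : Matrix (Fin n) (Fin n) k, e * bichar A = bichar (A + D) := by
  induction D using Matrix.induction_on' with
  | h_zero => exact ⟨1, fun A => by rw [one_mul, add_zero]⟩
  | h_add D D' h h' =>
    obtain ⟨e, he⟩ := h
    obtain ⟨e', he'⟩ := h'
    exact ⟨e' * e, fun A => by rw [mul_assoc, he, he', add_assoc]⟩
  | h_std_basis i j s =>
    have : Matrix.single i j s = Matrix.vecMulVec (Pi.single i s) (Pi.single j 1) := by
      ext a b
      simp only [Matrix.single, Matrix.vecMulVec, Matrix.of_apply, Pi.single_apply]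
      split_ifs <;> simp_all
    rw [this]
    exact exists_mul_bichar_of_rank_one _ _

/-- The invertible element `r_A` of the convolution algebra. -/
def bicharUnit (A : Matrix (Fin n) (Fin n) k) : (Form k (HopfE k n))ˣ := (isUnit_bichar A).unit

/-- The product $r_A*r_B^{-1}$ is the factor that shifts every matrix by $A-B$. -/
theorem bicharUnit_mul_inv_mul (A B C : Matrix (Fin n) (Fin n) k) :
    bicharUnit A * (bicharUnit B)⁻¹ * bicharUnit C = bicharUnit (A - B + C) := by
  obtain ⟨e, he⟩ := exists_mul_bichar (A - B)
  have h1 : (bicharUnit A : Form k (HopfE k n)) = e * bicharUnit B := by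
    change bichar A = e * bichar B
    rw [he, add_sub_cancel]
  apply Units.ext
  rw [Units.val_mul, Units.val_mul, h1, Units.mul_inv_cancel_right]
  change e * bichar C = bichar _
  rw [he, add_comm]

end HopfE

section Forms

variable {k : Type*} [Field k] {H : Type*} [Ring H] [Bialgebra k H]

/-! ### Lazy cocycles from pairs of coquasi-triangular structures -/

variable (k H) in
/-- `(g ⊗ h) ⊗ m ↦ ε(h) g ⊗ m`. -/
def proj13 : (H ⊗[k] H) ⊗[k] H →ₗc[k] H ⊗[k] H :=
  Coalgebra.TensorProduct.map ((Coalgebra.TensorProduct.rid k k H).toCoalgHom.comp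
    (Coalgebra.TensorProduct.map (CoalgHom.id k H) (Coalgebra.counitCoalgHom k H)))
    (CoalgHom.id k H)

theorem proj13_tmul (g h m : H) :
    proj13 k H ((g ⊗ₜ h) ⊗ₜ m) = (Coalgebra.counit (R := k) h • g) ⊗ₜ m := rfl

variable (k H) in
/-- `(g ⊗ h) ⊗ m ↦ (h ⊗ g) ⊗ m`. -/
def swap12 : (H ⊗[k] H) ⊗[k] H →ₗc[k] (H ⊗[k] H) ⊗[k] H :=
  Coalgebra.TensorProduct.map (Bialgebra.TensorProduct.comm k H H : H ⊗[k] H →ₗc[k] H ⊗[k] H)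
    (CoalgHom.id k H)

theorem swap12_tmul (g h m : H) : swap12 k H ((g ⊗ₜ h) ⊗ₜ m) = (h ⊗ₜ g) ⊗ₜ m := rfl

variable (k H) in
/-- `(g ⊗ h) ⊗ m ↦ (g ⊗ m) ⊗ h`. -/
def swap23 : (H ⊗[k] H) ⊗[k] H →ₗc[k] (H ⊗[k] H) ⊗[k] H :=
  (Coalgebra.TensorProduct.assoc k k H H H).symm.toCoalgHom.comp
    ((Coalgebra.TensorProduct.map (CoalgHom.id k H)
      (Bialgebra.TensorProduct.comm k H H : H ⊗[k] H →ₗc[k] H ⊗[k] H)).comp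
        (Coalgebra.TensorProduct.assoc k k H H H).toCoalgHom)

theorem swap23_tmul (g h m : H) : swap23 k H ((g ⊗ₜ h) ⊗ₜ m) = (g ⊗ₜ m) ⊗ₜ h := rfl

theorem pull_swap12_proj13 (r : Form k H) :
    convPull (swap12 k H) (convPull (proj13 k H) r) = convPull (proj23 k H) r :=
  Form.ext3 fun _ _ _ => rfl

theorem pull_swap12_proj23 (r : Form k H) :
    convPull (swap12 k H) (convPull (proj23 k H) r) = convPull (proj13 k H) r :=
  Form.ext3 fun _ _ _ => rfl

theorem pull_swap23_proj13 (r : Form k H) :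
    convPull (swap23 k H) (convPull (proj13 k H) r) = convPull (proj12 k H) r :=
  Form.ext3 fun a b c => by
    simp only [convPull_apply, swap23_tmul, proj13_tmul, proj12_tmul, smul_tmul']

theorem pull_swap23_proj12 (r : Form k H) :
    convPull (swap23 k H) (convPull (proj12 k H) r) = convPull (proj13 k H) r :=
  Form.ext3 fun a b c => by
    simp only [convPull_apply, swap23_tmul, proj13_tmul, proj12_tmul, smul_tmul']

/-- Counterpart of `mul_pull12` for the opposite product: the pull-back of `f` reads $f(hg\otimes
m)$, the form in which the commutation axiom is used in `braid12`. -/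
theorem mul_pull_swap12 (σ f : Form k H) (g h m : H) :
    (convPull (swap12 k H) (convPull (mul12 k H) f) * convPull (proj12 k H) σ) ((g ⊗ₜ h) ⊗ₜ m) =
      f ((mulOpConv k H * σ.toH) (g ⊗ₜ h) ⊗ₜ m) := by
  have rg := Coalgebra.Repr.arbitrary k g
  have rh := Coalgebra.Repr.arbitrary k h
  have rm := Coalgebra.Repr.arbitrary k m
  have e (a b : H) : mulOpConv k H (a ⊗ₜ b) = b * a := rfl
  rw [conv_apply3 _ _ rg rh rm, conv_apply2 _ _ rg rh]
  simp only [convPull_apply, proj12_tmul, mul12_tmul, swap12_tmul, toH_apply, e, sum_tmul,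
    map_sum, map_smul, smul_eq_mul, ← Algebra.commutes, ← Algebra.smul_def,
    ← smul_tmul']
  refine Finset.sum_congr rfl fun i _ => Finset.sum_congr rfl fun j _ => ?_
  conv_rhs => rw [← sum_right_counit_smul (k := k) rm]
  simp only [tmul_sum, map_sum, Finset.mul_sum, tmul_smul, map_smul,
    smul_eq_mul]
  exact Finset.sum_congr rfl fun l _ => by ring

theorem mul_pull_swap23 (σ f : Form k H) (g h m : H) :
    (convPull (swap23 k H) (convPull (mul23 k H) f) * convPull (proj23 k H) σ) ((g ⊗ₜ h) ⊗ₜ m) =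
      f (g ⊗ₜ (mulOpConv k H * σ.toH) (h ⊗ₜ m)) := by
  have rg := Coalgebra.Repr.arbitrary k g
  have rh := Coalgebra.Repr.arbitrary k h
  have rm := Coalgebra.Repr.arbitrary k m
  have e (a b : H) : mulOpConv k H (a ⊗ₜ b) = b * a := rfl
  rw [conv_apply3 _ _ rg rh rm, conv_apply2 _ _ rh rm]
  -- The sum over the components of $g$ is moved innermost, where the counit collapses it.
  rw [Finset.sum_comm]
  simp_rw [Finset.sum_comm (s := rg.index)]
  simp only [convPull_apply, proj23_tmul, mul23_tmul, swap23_tmul, toH_apply, e, tmul_sum,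
    map_sum, map_smul, smul_eq_mul, ← Algebra.commutes, ← Algebra.smul_def,
    ← smul_tmul', tmul_smul]
  refine Finset.sum_congr rfl fun i _ => Finset.sum_congr rfl fun j _ => ?_
  conv_rhs => rw [← sum_right_counit_smul (k := k) rg]
  simp only [sum_tmul, map_sum, Finset.mul_sum, ← smul_tmul', map_smul,
    smul_eq_mul]
  exact Finset.sum_congr rfl fun l _ => by ring

/-- A redundant counit is inserted so that a two-variable expression matches the three Sweedler sums
of `conv_apply3`. -/
theorem Form.apply_sum_counit_left (r : Form k H) {g : H} {ι : Type*} (rg : Coalgebra.Repr k g ι)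
    (m : H) : r (g ⊗ₜ m) =
      ∑ i ∈ rg.index, Coalgebra.counit (R := k) (rg.right i) * r (rg.left i ⊗ₜ m) := by
  conv_lhs => rw [← sum_right_counit_smul (k := k) rg]
  simp only [sum_tmul, map_sum, ← smul_tmul', map_smul, smul_eq_mul]

theorem Form.apply_sum_counit_left' (r : Form k H) {g : H} {ι : Type*} (rg : Coalgebra.Repr k g ι)
    (m : H) : r (g ⊗ₜ m) =
      ∑ i ∈ rg.index, Coalgebra.counit (R := k) (rg.left i) * r (rg.right i ⊗ₜ m) := by
  conv_lhs => rw [← Coalgebra.sum_counit_smul (R := k) rg]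
  simp only [sum_tmul, map_sum, ← smul_tmul', map_smul, smul_eq_mul]

theorem Form.apply_sum_counit_right (r : Form k H) {g : H} {ι : Type*} (rg : Coalgebra.Repr k g ι)
    (m : H) : r (m ⊗ₜ g) =
      ∑ i ∈ rg.index, Coalgebra.counit (R := k) (rg.right i) * r (m ⊗ₜ rg.left i) := by
  conv_lhs => rw [← sum_right_counit_smul (k := k) rg]
  simp only [tmul_sum, map_sum, tmul_smul, map_smul, smul_eq_mul]

theorem Form.apply_sum_counit_right' (r : Form k H) {g : H} {ι : Type*} (rg : Coalgebra.Repr k g ι)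
    (m : H) : r (m ⊗ₜ g) =
      ∑ i ∈ rg.index, Coalgebra.counit (R := k) (rg.left i) * r (m ⊗ₜ rg.right i) := by
  conv_lhs => rw [← Coalgebra.sum_counit_smul (R := k) rg]
  simp only [tmul_sum, map_sum, tmul_smul, map_smul, smul_eq_mul]

namespace Form.IsCoquasitriangular

variable {r s : Form k H}

/-- Left multiplicativity as an identity in the convolution algebra on $H\otimes H\otimes H$:
$r(gh\otimes m)$ becomes $r_{13}*r_{23}$. -/
theorem pull_mul12 (hr : r.IsCoquasitriangular) :
    convPull (mul12 k H) r = convPull (proj13 k H) r * convPull (proj23 k H) r :=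
  Form.ext3 fun g h m => by
    have rg := Coalgebra.Repr.arbitrary k g
    have rh := Coalgebra.Repr.arbitrary k h
    have rm := Coalgebra.Repr.arbitrary k m
    rw [conv_apply3 _ _ rg rh rm, convPull_apply, mul12_tmul, hr.mul_left, rm.convMul_apply]
    simp only [LinearMap.comp_apply, TensorProduct.mk_apply]
    simp only [r.apply_sum_counit_left rg, r.apply_sum_counit_left' rh, Finset.sum_mul_sum,
      convPull_apply, proj13_tmul, proj23_tmul, ← smul_tmul', map_smul, smul_eq_mul]
    rw [Finset.sum_comm]
    refine Finset.sum_congr rfl fun i _ => ?_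
    rw [Finset.sum_comm]
    exact Finset.sum_congr rfl fun j _ => Finset.sum_congr rfl fun l _ => by ring

theorem pull_mul23 (hr : r.IsCoquasitriangular) :
    convPull (mul23 k H) r = convPull (proj13 k H) r * convPull (proj12 k H) r :=
  Form.ext3 fun g h m => by
    have rg := Coalgebra.Repr.arbitrary k g
    have rh := Coalgebra.Repr.arbitrary k h
    have rm := Coalgebra.Repr.arbitrary k m
    rw [conv_apply3 _ _ rg rh rm, convPull_apply, mul23_tmul, hr.mul_right, rg.convMul_apply]
    simp only [LinearMap.comp_apply, LinearMap.flip_apply, TensorProduct.mk_apply]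
    simp only [r.apply_sum_counit_right rm, r.apply_sum_counit_right' rh, Finset.sum_mul_sum,
      convPull_apply, proj13_tmul, proj12_tmul, ← smul_tmul', map_smul, smul_eq_mul]
    refine Finset.sum_congr rfl fun i _ => ?_
    rw [Finset.sum_comm]
    exact Finset.sum_congr rfl fun j _ => Finset.sum_congr rfl fun l _ => by ring

/-- Yang–Baxter relation with two structures: only multiplicativity of $r$ and the commutation axiom
of $s$ are used, so the two may differ. -/
theorem braid12 (hr : r.IsCoquasitriangular) (hs : s.IsCoquasitriangular) :
    convPull (proj12 k H) s * (convPull (proj13 k H) r * convPull (proj23 k H) r) =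
      convPull (proj23 k H) r * convPull (proj13 k H) r * convPull (proj12 k H) s := by
  have e : convPull (swap12 k H) (convPull (mul12 k H) r) =
      convPull (proj23 k H) r * convPull (proj13 k H) r := by
    rw [hr.pull_mul12, map_mul, pull_swap12_proj13, pull_swap12_proj23]
  rw [← e, ← hr.pull_mul12]
  exact Form.ext3 fun g h m => by rw [pull12_mul, mul_pull_swap12, hs.comm]

theorem braid23 (hr : r.IsCoquasitriangular) (hs : s.IsCoquasitriangular) :
    convPull (proj23 k H) s * (convPull (proj13 k H) r * convPull (proj12 k H) r) =
      convPull (proj12 k H) r * convPull (proj13 k H) r * convPull (proj23 k H) s := by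
  have e : convPull (swap23 k H) (convPull (mul23 k H) r) =
      convPull (proj12 k H) r * convPull (proj13 k H) r := by
    rw [hr.pull_mul23, map_mul, pull_swap23_proj13, pull_swap23_proj12]
  rw [← e, ← hr.pull_mul23]
  exact Form.ext3 fun g h m => by rw [pull23_mul, mul_pull_swap23, hs.comm]

end Form.IsCoquasitriangular

/-- The cocycle identity for $r^{-1}s$ in group form. The mixed relation `h1` moves $s_{12}$ to the
right of the inverse, the Yang–Baxter relations of $r$ and $s$ reverse both triple products, and
`h2` moves $s_{23}$ back. -/
theorem inv_mul_mul_inv_mul_eq {G : Type*} [Group G] {r₁₂ r₁₃ r₂₃ s₁₂ s₁₃ s₂₃ : G}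
    (h1 : s₁₂ * (r₁₃ * r₂₃) = r₂₃ * r₁₃ * s₁₂) (h2 : s₂₃ * (r₁₃ * r₁₂) = r₁₂ * r₁₃ * s₂₃)
    (hr : r₁₂ * (r₁₃ * r₂₃) = r₂₃ * r₁₃ * r₁₂) (hs : s₁₂ * (s₁₃ * s₂₃) = s₂₃ * s₁₃ * s₁₂) :
    r₁₂⁻¹ * s₁₂ * ((r₁₃ * r₂₃)⁻¹ * (s₁₃ * s₂₃)) = r₂₃⁻¹ * s₂₃ * ((r₁₃ * r₁₂)⁻¹ * (s₁₃ * s₁₂)) := by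
  have h1' : s₁₂ * (r₁₃ * r₂₃)⁻¹ = (r₂₃ * r₁₃)⁻¹ * s₁₂ := by
    rw [mul_inv_eq_iff_eq_mul, mul_assoc, h1, ← mul_assoc, inv_mul_cancel, one_mul]
  have h2' : s₂₃ * (r₁₃ * r₁₂)⁻¹ = (r₁₂ * r₁₃)⁻¹ * s₂₃ := by
    rw [mul_inv_eq_iff_eq_mul, mul_assoc, h2, ← mul_assoc, inv_mul_cancel, one_mul]
  calc r₁₂⁻¹ * s₁₂ * ((r₁₃ * r₂₃)⁻¹ * (s₁₃ * s₂₃))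
      = r₁₂⁻¹ * (s₁₂ * (r₁₃ * r₂₃)⁻¹) * (s₁₃ * s₂₃) := by group
    _ = (r₂₃ * r₁₃ * r₁₂)⁻¹ * (s₁₂ * (s₁₃ * s₂₃)) := by rw [h1']; group
    _ = (r₁₂ * (r₁₃ * r₂₃))⁻¹ * (s₂₃ * s₁₃ * s₁₂) := by rw [← hr, hs]
    _ = r₂₃⁻¹ * ((r₁₂ * r₁₃)⁻¹ * s₂₃) * (s₁₃ * s₁₂) := by group
    _ = _ := by rw [← h2']; group

/-- For coquasi-triangular structures `r`, `s`, the form `r⁻¹ * s` is a lazy cocycle. -/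
theorem inv_mul_mem_lazyCocycles {r s : (Form k H)ˣ} (hr : (r : Form k H).IsCoquasitriangular)
    (hs : (s : Form k H).IsCoquasitriangular) : r⁻¹ * s ∈ lazyCocycles k H := by
  refine ⟨?_, ?_⟩
  · rw [Form.isLeftCocycle_iff]
    have e12 (t : (Form k H)ˣ) (ht : (t : Form k H).IsCoquasitriangular) :
        Units.map (convPull (mul12 k H)) t =
          Units.map (convPull (proj13 k H)) t * Units.map (convPull (proj23 k H)) t :=
      Units.ext ht.pull_mul12
    have e23 (t : (Form k H)ˣ) (ht : (t : Form k H).IsCoquasitriangular) :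
        Units.map (convPull (mul23 k H)) t =
          Units.map (convPull (proj13 k H)) t * Units.map (convPull (proj12 k H)) t :=
      Units.ext ht.pull_mul23
    have := inv_mul_mul_inv_mul_eq
      (r₁₂ := Units.map (convPull (proj12 k H)) r) (s₁₂ := Units.map (convPull (proj12 k H)) s)
      (r₁₃ := Units.map (convPull (proj13 k H)) r) (s₁₃ := Units.map (convPull (proj13 k H)) s)
      (r₂₃ := Units.map (convPull (proj23 k H)) r) (s₂₃ := Units.map (convPull (proj23 k H)) s)
      (Units.ext (hr.braid12 hs)) (Units.ext (hr.braid23 hs)) (Units.ext (hr.braid12 hr))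
      (Units.ext (hs.braid12 hs))
    rw [← e12 r hr, ← e12 s hs, ← e23 r hr, ← e23 s hs, ← map_inv, ← map_inv, ← map_inv,
      ← map_inv, ← map_mul, ← map_mul, ← map_mul, ← map_mul] at this
    exact congrArg Units.val this
  -- Laziness: $s$ carries the product to the opposite product and $r^{-1}$ carries it back.
  · have e1 : (((Units.map (toHHom k H) r)⁻¹ : _) : WithConv (H ⊗[k] H →ₗ[k] H)) *
        mulOpConv k H = mulConv k H * ((Units.map (toHHom k H) r)⁻¹ : _) := by
      rw [Units.inv_mul_eq_iff_eq_mul, ← mul_assoc, Units.eq_mul_inv_iff_mul_eq]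
      exact hr.comm.symm
    have e2 : ((r⁻¹ * s : (Form k H)ˣ) : Form k H).toH =
        ((Units.map (toHHom k H) r)⁻¹ : (WithConv (H ⊗[k] H →ₗ[k] H))ˣ) * (s : Form k H).toH :=
      map_mul (toHHom k H) _ _
    rw [Form.IsLazy, e2, mul_assoc, hs.comm, ← mul_assoc, e1, mul_assoc]

end Forms

/-! ### Symmetric difference implies same orbit -/

namespace HopfE

variable {k : Type*} [Field k] {n : ℕ}

theorem flip_inv_mul (σ ω : (Form k (HopfE k n))ˣ) :
    ((σ⁻¹ * ω : (Form k (HopfE k n))ˣ) : Form k (HopfE k n)).flip =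
      ((σ⁻¹ : (Form k (HopfE k n))ˣ) : Form k (HopfE k n)).flip * (ω : Form k (HopfE k n)).flip :=
  flip_mul _ _

theorem flip_bicharUnit (A : Matrix (Fin n) (Fin n) k) :
    (bicharUnit A : Form k (HopfE k n)).flip = ((bicharUnit A.transpose)⁻¹ : (Form k _)ˣ) := by
  rw [← Units.mul_eq_one_iff_eq_inv]
  exact flip_bichar_mul_bichar A

theorem flip_bicharUnit_inv (A : Matrix (Fin n) (Fin n) k) :
    (((bicharUnit A)⁻¹ : (Form k (HopfE k n))ˣ) : Form k (HopfE k n)).flip =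
      bicharUnit A.transpose := by
  rw [← flip_flip (bicharUnit A.transpose : Form k (HopfE k n)), flip_bicharUnit,
    Matrix.transpose_transpose]

/-- With $\sigma=r_0^{-1}*r_M$, symmetry of $M$ gives $\sigma\tau=r_0*r_M^{-1}$. Both sides of $r_A$
then subtract $M$, so the half of $A-B$ is the right choice. -/
theorem sameLazyOrbit_bichar (hk : (2 : k) ≠ 0) {A B : Matrix (Fin n) (Fin n) k}
    (h : (A - B).IsSymm) : SameLazyOrbit (bichar A) (bichar B) := by
  set M : Matrix (Fin n) (Fin n) k := (2 : k)⁻¹ • (A - B) with hM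
  have hMt : M.transpose = M := by rw [hM, Matrix.transpose_smul, h.eq]
  have hMM : M + M = A - B := by
    rw [← two_smul k M, hM, smul_smul, mul_inv_cancel₀ hk, one_smul]
  refine ⟨(bicharUnit 0)⁻¹ * bicharUnit M, inv_mul_mem_lazyCocycles
    (isCoquasitriangular_bichar _) (isCoquasitriangular_bichar _), ?_⟩
  have e : bicharUnit 0 * (bicharUnit M)⁻¹ * bicharUnit A * ((bicharUnit 0)⁻¹ * bicharUnit M)⁻¹ =
      bicharUnit B := by
    rw [bicharUnit_mul_inv_mul, mul_inv_rev, inv_inv, ← mul_assoc, bicharUnit_mul_inv_mul]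
    congr 1
    rw [zero_sub, add_zero, ← sub_eq_zero]
    have : A - B - (M + M) = 0 := by rw [hMM, sub_self]
    rw [← this]
    abel
  rw [twist, flip_inv_mul, flip_bicharUnit, flip_bicharUnit_inv, hMt, Matrix.transpose_zero]
  exact congrArg Units.val e

end HopfE

namespace HopfE

variable {k : Type*} [Field k] {n : ℕ}

/-! ### Values of the bicharacter on the basis -/

/-- `l ↦ ∑ f(l₁) l₂`. -/
def contract (f : WithConv (HopfE k n →ₗ[k] k)) : WithConv (HopfE k n →ₗ[k] HopfE k n) :=
  scalarConv k _ _ f * idConv k n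

theorem mul_apply_contract (f g : WithConv (HopfE k n →ₗ[k] k)) (l : HopfE k n) :
    (f * g) l = g (contract f l) := by
  have r := Coalgebra.Repr.arbitrary k l
  rw [r.convMul_apply, contract, r.convMul_apply, map_sum]
  refine Finset.sum_congr rfl fun i _ => ?_
  rw [scalarConv_apply, ← Algebra.smul_def, map_smul, smul_eq_mul]
  rfl

theorem contract_c_mul (f : WithConv (HopfE k n →ₗ[k] k)) (l : HopfE k n) :
    contract f (c k n * l) = c k n * contract (transC f) l := by
  rw [← transC_apply, contract, transC_mul, transC_scalarConv, transC_idConv,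
    scalarConv_mul_const_assoc, constConv_mul_apply, contract]

theorem contract_x_mul (f : WithConv (HopfE k n →ₗ[k] k)) (i : Fin n) (l : HopfE k n) :
    contract f (x k i * l) = x k i * contract f l + c k n * contract (transX i f) l := by
  rw [← transX_apply, contract, transX_mul, transX_scalarConv, transC_idConv, transX_idConv,
    scalarConv_mul_const_assoc, scalarConv_mul_const_assoc, ofConv_add, LinearMap.add_apply,
    constConv_mul_apply, constConv_mul_apply, contract]

theorem contract_chi_xP (P : Finset (Fin n)) : contract (chi k n) (xP k P) = xP k P := by
  induction P using Finset.induction_on_min with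
  | empty =>
    rw [xP_empty, contract, conv_one_apply, scalarConv_apply, chi_one, map_one, one_mul]
    rfl
  | insert p P hp ih =>
    rw [xP_insert hp, contract_x_mul, ih, transX_chi, contract, map_zero, zero_mul]
    simp

/-- Contraction as in an exterior algebra: removing $x_f$ leaves a $c$ in its place, and moving it
to the front past the smaller factors costs $(-1)^{\mathrm{below}}$. -/
theorem contract_xi_xP (v : Fin n → k) (P : Finset (Fin n)) :
    contract (xi v) (xP k P) =
      ∑ f ∈ P, (v f * (-1) ^ below f P) • (c k n * xP k (P.erase f)) := by
  induction P using Finset.induction_on_min with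
  | empty =>
    rw [xP_empty, contract, conv_one_apply, scalarConv_apply, xi_one, map_zero, zero_mul,
      Finset.sum_empty]
  | insert p P hp ih =>
    have hpP : p ∉ P := fun h => lt_irrefl _ (hp p h)
    have h0 : below p (insert p P) = 0 := by
      rw [below, Finset.card_eq_zero, Finset.filter_eq_empty_iff]
      intro j hj
      rcases Finset.mem_insert.1 hj with rfl | hj
      · exact lt_irrefl _
      · exact (hp j hj).not_gt
    have hsm : contract (v p • (1 : WithConv (HopfE k n →ₗ[k] k))) (xP k P) = v p • xP k P := by
      rw [contract, map_smul, map_one, smul_mul_assoc, one_mul]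
      rfl
    rw [xP_insert hp, contract_x_mul, ih, transX_xi, hsm, Finset.sum_insert hpP, h0, pow_zero,
      mul_one, Finset.erase_insert hpP, mul_smul_comm, add_comm, Finset.mul_sum]
    congr 1
    refine Finset.sum_congr rfl fun f hf => ?_
    have hpf : p < f := hp f hf
    rw [below_insert hpP, if_pos hpf, Finset.erase_insert_of_ne hpf.ne,
      xP_insert (fun j hj => hp j (Finset.mem_of_mem_erase hj)), mul_smul_comm, pow_succ,
      ← mul_assoc (x k p), ← neg_eq_iff_eq_neg.2 (c_mul_x (k := k) p), neg_mul, mul_assoc (c k n)]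
    simp

theorem contract_xi_c_mul (v : Fin n → k) (l : HopfE k n) :
    contract (xi v) (c k n * l) = -(c k n * contract (xi v) l) := by
  rw [contract_c_mul, transC_xi, contract, contract, scalarConv_neg', conv_neg_mul]
  simp

theorem contract_chi_c_mul (l : HopfE k n) :
    contract (chi k n) (c k n * l) = -(c k n * contract (chi k n) l) := by
  rw [contract_c_mul, transC_chi, contract, contract, scalarConv_neg', conv_neg_mul]
  simp

variable (A : Matrix (Fin n) (Fin n) k)

theorem bichar_x_mul (i : Fin n) (h l : HopfE k n) :
    bichar A ((x k i * h) ⊗ₜ l) = bichar A (h ⊗ₜ contract (xi (A i)) l) := by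
  rw [bichar_tmul, bichar_tmul, map_mul, rho_x, mul_apply_contract]

theorem bichar_c_mul (h l : HopfE k n) :
    bichar A ((c k n * h) ⊗ₜ l) = bichar A (h ⊗ₜ contract (chi k n) l) := by
  rw [bichar_tmul, bichar_tmul, map_mul, rho_c, mul_apply_contract]

theorem bichar_one_tmul (l : HopfE k n) :
    bichar A (1 ⊗ₜ l) = Coalgebra.counit (R := k) l := by
  rw [bichar_tmul, map_one]
  rfl

/-- Each of the $|P|$ contractions by some $\xi$ anticommutes with left multiplication by $c$. -/
theorem bichar_xP_c_mul (P : Finset (Fin n)) (l : HopfE k n) :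
    bichar A (xP k P ⊗ₜ (c k n * l)) = (-1) ^ P.card * bichar A (xP k P ⊗ₜ l) := by
  induction P using Finset.induction_on_min generalizing l with
  | empty => simp [xP_empty, bichar_one_tmul, counit_eq]
  | insert p P hp ih =>
    rw [xP_insert hp, bichar_x_mul, contract_xi_c_mul, bichar_x_mul, tmul_neg, map_neg, ih,
      Finset.card_insert_of_notMem fun h => lt_irrefl _ (hp p h), pow_succ]
    ring

/-- The minor of `A` with rows `P` and columns `F`, zero unless `|F| = |P|`. -/
def minor (P F : Finset (Fin n)) : k := if h : F.card = P.card then minorSum A P F h else 0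

theorem minorSum_eq_det (P F : Finset (Fin n)) (h : F.card = P.card) :
    minorSum A P F h =
      (A.submatrix (P.orderEmbOfFin rfl) (F.orderEmbOfFin h)).det := by
  rw [← Matrix.det_transpose, Matrix.det_apply']
  rfl

/-- The size $s$ is a free variable, so that determinants for `insert p P` and `F.erase f` can be
compared without transport along equalities of cardinals. -/
theorem minor_eq_det {s : ℕ} {P F : Finset (Fin n)} (hP : P.card = s) (hF : F.card = s) :
    minor A P F = (A.submatrix (P.orderEmbOfFin hP) (F.orderEmbOfFin hF)).det := by
  subst hP
  rw [minor, dif_pos hF, minorSum_eq_det]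

theorem orderEmbOfFin_insert_min {p : Fin n} {P : Finset (Fin n)} (hp : ∀ j ∈ P, p < j) {s : ℕ}
    (h : (insert p P).card = s + 1) (hP : P.card = s) :
    ((insert p P).orderEmbOfFin h : Fin (s + 1) → Fin n) = Fin.cons p (P.orderEmbOfFin hP) := by
  symm
  refine Finset.orderEmbOfFin_unique h (fun i => ?_) ?_
  · refine Fin.cases ?_ (fun i => ?_) i
    · simp
    · simp
  · intro i j hij
    induction j using Fin.cases with
    | zero => exact absurd hij (Fin.not_lt_zero i)
    | succ j =>
      induction i using Fin.cases with
      | zero => exact hp _ (Finset.orderEmbOfFin_mem P hP j)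
      | succ i => exact (P.orderEmbOfFin hP).strictMono (Fin.succ_lt_succ_iff.1 hij)

theorem orderEmbOfFin_erase {F : Finset (Fin n)} {s : ℕ} (h : F.card = s + 1) (j : Fin (s + 1))
    (h' : (F.erase (F.orderEmbOfFin h j)).card = s) :
    ((F.erase (F.orderEmbOfFin h j)).orderEmbOfFin h' : Fin s → Fin n) =
      F.orderEmbOfFin h ∘ j.succAbove := by
  symm
  refine Finset.orderEmbOfFin_unique h' (fun i => ?_) ?_
  · simp [Fin.succAbove_ne]
  · exact (F.orderEmbOfFin h).strictMono.comp (Fin.strictMono_succAbove j)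

theorem below_orderEmbOfFin {F : Finset (Fin n)} {s : ℕ} (h : F.card = s) (j : Fin s) :
    below (F.orderEmbOfFin h j) F = j := by
  have : F.filter (· < F.orderEmbOfFin h j) = (Finset.univ.filter (· < j)).map
      (F.orderEmbOfFin h).toEmbedding := by
    ext a
    simp only [Finset.mem_filter, Finset.mem_map, Finset.mem_univ, true_and]
    constructor
    · rintro ⟨ha, hlt⟩
      obtain ⟨i, rfl⟩ : a ∈ Set.range (F.orderEmbOfFin h) := by
        rw [Finset.range_orderEmbOfFin]; exact ha
      exact ⟨i, (F.orderEmbOfFin h).lt_iff_lt.1 hlt, rfl⟩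
    · rintro ⟨i, hi, rfl⟩
      exact ⟨Finset.orderEmbOfFin_mem F h i, (F.orderEmbOfFin h).lt_iff_lt.2 hi⟩
  rw [below, this, Finset.card_map, Finset.filter_gt_eq_Iio, Fin.card_Iio]

/-- Laplace expansion along the first row, which is row $p$ because $p$ lies below $P$; the column
index of $f$ is the number of elements of $F$ below it. -/
theorem minor_insert {p : Fin n} {P : Finset (Fin n)} (hp : ∀ j ∈ P, p < j)
    (F : Finset (Fin n)) : minor A (insert p P) F =
      ∑ f ∈ F, (-1) ^ below f F * A p f * minor A P (F.erase f) := by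
  have hpP : p ∉ P := fun h => lt_irrefl _ (hp p h)
  have hc : (insert p P).card = P.card + 1 := Finset.card_insert_of_notMem hpP
  by_cases hF : F.card = P.card + 1
  · have he (j : Fin (P.card + 1)) : (F.erase (F.orderEmbOfFin hF j)).card = P.card := by
      rw [Finset.card_erase_of_mem (Finset.orderEmbOfFin_mem F hF j), hF, Nat.add_sub_cancel]
    have hsum : ∑ f ∈ F, (-1) ^ below f F * A p f * minor A P (F.erase f) =
        ∑ j : Fin (P.card + 1), (-1) ^ below (F.orderEmbOfFin hF j) F *
          A p (F.orderEmbOfFin hF j) * minor A P (F.erase (F.orderEmbOfFin hF j)) := by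
      conv_lhs => rw [← Finset.map_orderEmbOfFin_univ F hF]
      rw [Finset.sum_map]
      rw [Finset.map_orderEmbOfFin_univ F hF]
      rfl
    rw [hsum, minor_eq_det A hc hF, Matrix.det_succ_row_zero]
    refine Finset.sum_congr rfl fun j _ => ?_
    rw [below_orderEmbOfFin, minor_eq_det A rfl (he j), orderEmbOfFin_insert_min hp hc rfl,
      orderEmbOfFin_erase]
    rfl
  -- For mismatched cardinalities every minor involved is zero by convention.
  · rw [minor, dif_neg (by rwa [hc]), Finset.sum_eq_zero]
    intro f hf
    rw [minor, dif_neg, mul_zero]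
    intro h
    rw [Finset.card_erase_of_mem hf] at h
    have := Finset.card_pos.2 ⟨f, hf⟩
    omega

theorem counit_xP (P : Finset (Fin n)) :
    Coalgebra.counit (R := k) (xP k P) = if P = ∅ then 1 else 0 := by
  induction P using Finset.induction_on_min with
  | empty => simp [xP_empty]
  | insert p P hp ih => rw [xP_insert hp]; simp [counit_eq]

/-- Peeling off the least $x_p$ contracts $x_F$ by $\xi_{A_p}$, which is the Laplace expansion up to
the $c$ left behind. That $c$ costs $(-1)^{|P|}$ at each stage, and the exponents $0,1,\dots,s-1$
add up to $s(s-1)/2$. -/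
theorem bichar_xP_xP (P F : Finset (Fin n)) : bichar A (xP k P ⊗ₜ xP k F) =
    (-1) ^ (P.card * (P.card - 1) / 2) * minor A P F := by
  induction P using Finset.induction_on_min generalizing F with
  | empty =>
    rw [xP_empty, bichar_one_tmul, counit_xP, minor]
    by_cases h : F = ∅
    · subst h
      rw [← minor, minor_eq_det A Finset.card_empty Finset.card_empty, Matrix.det_fin_zero]
      simp
    · rw [if_neg h, dif_neg (by simpa using h), mul_zero]
  | insert p P hp ih =>
    have hpP : p ∉ P := fun h => lt_irrefl _ (hp p h)
    have hexp : (P.card + 1) * (P.card + 1 - 1) / 2 = P.card * (P.card - 1) / 2 + P.card := by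
      rw [← Finset.sum_range_id_mul_two, ← Finset.sum_range_id_mul_two, Finset.sum_range_succ]
      omega
    rw [xP_insert hp, bichar_x_mul, contract_xi_xP, tmul_sum, map_sum, minor_insert A hp,
      Finset.mul_sum]
    refine Finset.sum_congr rfl fun f _ => ?_
    rw [tmul_smul, map_smul, bichar_xP_c_mul, ih, smul_eq_mul,
      Finset.card_insert_of_notMem hpP, hexp, pow_add]
    ring

theorem basis_apply (p : Bool × Finset (Fin n)) : basis k n p = basisVec k p := by
  simp [basis]

theorem dualTensor_basis (u v p q : Bool × Finset (Fin n)) :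
    dualTensor (k := k) u v (basisVec k p ⊗ₜ basisVec k q) =
      (if p = u then 1 else 0) * (if q = v then 1 else 0) := by
  rw [← basis_apply, ← basis_apply, dualTensor, dualDistrib_apply, Module.Basis.coord_apply,
    Module.Basis.coord_apply, Module.Basis.repr_self, Module.Basis.repr_self,
    Finsupp.single_apply, Finsupp.single_apply]

/-- The sign in front of `(c^a x_P)^* ⊗ (c^b x_F)^*` in `r_A`, where `s = |P|`. -/
def rSign (k : Type*) [Field k] (s : ℕ) : Bool → Bool → k
  | _, false => 1
  | false, true => (-1) ^ s
  | true, true => -(-1) ^ s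

theorem rForm_basis (a b : Bool) (P F : Finset (Fin n)) :
    rForm A (basisVec k (a, P) ⊗ₜ basisVec k (b, F)) =
      (-1) ^ (P.card * (P.card - 1) / 2) * (minor A P F * rSign k P.card a b) := by
  have key (Q G : Finset (Fin n)) : (if h : G.card = Q.card then
      minorSum A Q G h •
        (dualTensor (false, Q) (false, G) + dualTensor (true, Q) (false, G)
          + (-1 : k) ^ Q.card • dualTensor (false, Q) (true, G)
          - (-1 : k) ^ Q.card • dualTensor (true, Q) (true, G))
      else 0 : HopfE k n ⊗[k] HopfE k n →ₗ[k] k) (basisVec k (a, P) ⊗ₜ basisVec k (b, F)) =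
      if Q = P then (if G = F then minor A P F * rSign k P.card a b else 0) else 0 := by
    by_cases hQ : Q = P
    · subst hQ
      by_cases hG : G = F
      · subst hG
        rw [if_pos rfl, if_pos rfl, minor]
        split_ifs with h
        · simp only [LinearMap.smul_apply, LinearMap.add_apply, LinearMap.sub_apply,
            dualTensor_basis, smul_eq_mul]
          cases a <;> cases b <;> simp [rSign]
        · simp
      · rw [if_pos rfl, if_neg hG]
        split_ifs with h
        · simp [dualTensor_basis, Ne.symm hG]
        · rfl
    · rw [if_neg hQ]
      split_ifs with h
      · simp [dualTensor_basis, Ne.symm hQ]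
      · rfl
  rw [rForm]
  simp only [LinearMap.sum_apply, LinearMap.smul_apply, key]
  simp

theorem rForm_eq_bichar : rForm A = bichar A := by
  refine WithConv.ext ((basis k n).tensorProduct (basis k n) |>.ext fun ⟨⟨a, P⟩, ⟨b, F⟩⟩ => ?_)
  rw [Module.Basis.tensorProduct_apply, basis_apply, basis_apply, rForm_basis]
  have h : bichar A (xP k P ⊗ₜ xP k F) = _ := bichar_xP_xP A P F
  cases a <;> cases b <;> simp only [basisVec, rSign, if_true, Bool.false_eq_true, if_false]
  · rw [h, mul_one]
  · rw [bichar_xP_c_mul, h]; ring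
  · rw [bichar_c_mul, contract_chi_xP, h, mul_one]
  · rw [bichar_c_mul, contract_chi_c_mul, contract_chi_xP, tmul_neg, map_neg, bichar_xP_c_mul, h]
    ring

end HopfE

namespace HopfE

variable {k : Type*} [Field k] {n : ℕ} {R : Type*} [Ring R] [Algebra k R]

/-! ### Orbits determine the antisymmetric part -/

theorem conv_tmul_c_one (F G : WithConv (HopfE k n ⊗[k] HopfE k n →ₗ[k] R)) :
    (F * G) (c k n ⊗ₜ 1) = F (c k n ⊗ₜ 1) * G (c k n ⊗ₜ 1) := by
  simp [LinearMap.convMul_apply, TensorProduct.comul_tmul, comul_eq,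
    Algebra.TensorProduct.one_def]

theorem conv_tmul_one_one (F G : WithConv (HopfE k n ⊗[k] HopfE k n →ₗ[k] R)) :
    (F * G) (1 ⊗ₜ 1) = F (1 ⊗ₜ 1) * G (1 ⊗ₜ 1) := by
  simp [LinearMap.convMul_apply, TensorProduct.comul_tmul, Algebra.TensorProduct.one_def]

theorem conv_tmul_c_x (F G : WithConv (HopfE k n ⊗[k] HopfE k n →ₗ[k] R)) (j : Fin n) :
    (F * G) (c k n ⊗ₜ x k j) =
      F (c k n ⊗ₜ 1) * G (c k n ⊗ₜ x k j) + F (c k n ⊗ₜ x k j) * G (c k n ⊗ₜ c k n) := by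
  simp [LinearMap.convMul_apply, TensorProduct.comul_tmul, comul_eq, tmul_add]

theorem conv_tmul_x_x (F G : WithConv (HopfE k n ⊗[k] HopfE k n →ₗ[k] R)) (i j : Fin n) :
    (F * G) (x k i ⊗ₜ x k j) =
      F (1 ⊗ₜ 1) * G (x k i ⊗ₜ x k j) + F (1 ⊗ₜ x k j) * G (x k i ⊗ₜ c k n) +
      (F (x k i ⊗ₜ 1) * G (c k n ⊗ₜ x k j) + F (x k i ⊗ₜ x k j) * G (c k n ⊗ₜ c k n)) := by
  simp [LinearMap.convMul_apply, TensorProduct.comul_tmul, comul_eq, tmul_add, add_tmul]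
  abel

theorem chi_c : chi k n (c k n) = -1 := by
  rw [← mul_one (c k n), ← transC_apply, transC_chi]
  simp

theorem chi_x (i : Fin n) : chi k n (x k i) = 0 := by
  rw [← mul_one (x k i), ← transX_apply, transX_chi]
  simp

theorem xi_c (v : Fin n → k) : xi v (c k n) = 0 := by
  rw [← mul_one (c k n), ← transC_apply, transC_xi]
  simp

theorem xi_x (v : Fin n → k) (i : Fin n) : xi v (x k i) = v i := by
  rw [← mul_one (x k i), ← transX_apply, transX_xi]
  simp [LinearMap.convOne_def]

/-- Laziness at $c\otimes x_j$ compares coefficients of $cx_j$; the functional $\xi_{(1,\dots,1)}$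
kills $1$ and $c$ but not $cx_j$. -/
theorem lazy_c_c_eq {σ : Form k (HopfE k n)} (hσ : σ.IsLazy) (j : Fin n) :
    σ (c k n ⊗ₜ c k n) = σ (c k n ⊗ₜ 1) := by
  have h := congrArg (fun F : WithConv (HopfE k n ⊗[k] HopfE k n →ₗ[k] HopfE k n) =>
    xi (fun _ => 1) (F (c k n ⊗ₜ x k j))) hσ
  simp only [conv_tmul_c_x, toH_apply, mulConv_tmul, c_mul_c, mul_one, ← Algebra.commutes (R := k),
    ← Algebra.smul_def, map_add, map_smul, xi_c, ← transC_apply, transC_xi, ofConv_neg,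
    LinearMap.neg_apply, xi_x, smul_eq_mul, mul_zero, zero_add] at h
  simpa [Algebra.algebraMap_eq_smul_one] using h.symm

/-- The cocycle identity at $(c,1,1)$ reads
$\sigma(c\otimes1)^2=\sigma(1\otimes1)\sigma(c\otimes1)$. The common factor is nonzero because
$c\otimes1$ is group-like and $\sigma$ is invertible. -/
theorem cocycle_c_one {σ : (Form k (HopfE k n))ˣ} (hσ : σ ∈ lazyCocycles k (HopfE k n)) :
    (σ : Form k (HopfE k n)) (c k n ⊗ₜ 1) = (σ : Form k (HopfE k n)) (1 ⊗ₜ 1) ∧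
      (σ : Form k (HopfE k n)) (1 ⊗ₜ 1) ≠ 0 := by
  have h := hσ.1 (c k n) 1 1
  rw [conv_tmul_c_one, conv_tmul_one_one, toH_apply, toH_apply, mulConv_tmul, mulConv_tmul, mul_one,
    mul_one, mul_one, ← Algebra.smul_def, ← smul_tmul', Algebra.algebraMap_eq_smul_one, tmul_smul,
    map_smul, map_smul, smul_eq_mul, smul_eq_mul] at h
  have hne : (σ : Form k (HopfE k n)) (c k n ⊗ₜ 1) ≠ 0 := by
    intro h0
    have := congrArg (fun F : Form k (HopfE k n) => F (c k n ⊗ₜ 1)) σ.mul_inv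
    simp only [conv_tmul_c_one, h0, zero_mul] at this
    simp [LinearMap.convOne_def, counit_eq] at this
  have e := mul_right_cancel₀ hne h
  exact ⟨e, e ▸ hne⟩

theorem isSymm_of_sameLazyOrbit {A B : Matrix (Fin n) (Fin n) k}
    (h : SameLazyOrbit (bichar A) (bichar B)) : (A - B).IsSymm := by
  obtain ⟨σ, hσ, h⟩ := h
  -- In the form $(\sigma\tau)*r_A=r_B*\sigma$ no value of $\sigma^{-1}$ is needed.
  rw [twist, Units.mul_inv_eq_iff_eq_mul] at h
  obtain ⟨h1, h0⟩ := cocycle_c_one hσ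
  have key (i j : Fin n) : (σ : Form k (HopfE k n)) (1 ⊗ₜ 1) * (A i j - B i j) =
      (σ : Form k (HopfE k n)) (x k i ⊗ₜ x k j) + (σ : Form k (HopfE k n)) (x k j ⊗ₜ x k i) := by
    have e := congrArg (fun F : Form k (HopfE k n) => F (x k i ⊗ₜ x k j)) h
    have hf (a b : HopfE k n) : (σ : Form k (HopfE k n)).flip (a ⊗ₜ b) =
      (σ : Form k (HopfE k n)) (b ⊗ₜ a) := rfl
    -- The value $r_A(c\otimes c)=-1$ gives $\sigma(x_j\otimes x_i)$ the sign that makes the final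
    -- expression a symmetric sum.
    simp only [conv_tmul_x_x, bichar_tmul, rho_x, rho_c, map_one, xi_x, xi_c, chi_c, chi_x, hf,
      lazy_c_c_eq hσ.2 j, h1] at e
    simp only [xi_one, LinearMap.convOne_apply, counit_eq, counitHom_x, map_one, map_zero] at e
    linear_combination e
  ext i j
  have : (σ : Form k (HopfE k n)) (1 ⊗ₜ 1) * (A j i - B j i) =
      (σ : Form k (HopfE k n)) (1 ⊗ₜ 1) * (A i j - B i j) := by
    rw [key, key, add_comm]
  exact mul_left_cancel₀ h0 this

end HopfE

end

/-! ### The main theorem -/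

theorem mainTheorem7 (k : Type*) [Field k] (hk : ringChar k ≠ 2) (n : ℕ) :
    (∀ A : Matrix (Fin n) (Fin n) k, (HopfE.rForm A).IsCoquasitriangular) ∧
      ∀ A B : Matrix (Fin n) (Fin n) k,
        SameLazyOrbit (HopfE.rForm A) (HopfE.rForm B) ↔ (A - B).IsSymm := by
  simp only [HopfE.rForm_eq_bichar]
  exact ⟨HopfE.isCoquasitriangular_bichar, fun A B =>
    ⟨HopfE.isSymm_of_sameLazyOrbit, HopfE.sameLazyOrbit_bichar (Ring.two_ne_zero hk)⟩⟩
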